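/- **Conventions.** All algebras are over $\mathbb{R}$ and bigraded by $\mathbb{Z}\times\mathbb{Z}_2$, with sign rule $xy=(-1)^{n_xn_y+\sigma_x\sigma_y}yx$. A super-$L_\infty$ algebra $\mathfrak{g}$ is given by its Chevalley--Eilenberg algebra $\mathrm{CE}(\mathfrak{g})$: a free graded-commutative superalgebra with a differential $\mathrm{d}$ (a graded derivation of bidegree $(1,\mathrm{evn})$, $\mathrm{d}^2=0$). A homomorphism $\mathfrak{g}\to\mathfrak{h}$ is a homomorphism $\mathrm{CE}(\mathfrak{h})\to\mathrm{CE}(\mathfrak{g})$ of differential bigraded algebras. Let $\Gamma_0,\dots,\Gamma_{10}$ be the Clifford generators of the real $32$-dimensional (Majorana) representation, $\Gamma_a\Gamma_b+\Gamma_b\Gamma_a=2\eta_{ab}$ with $\eta=\mathrm{diag}(-1,1,\dots,1)$ and $\Gamma_0\cdots\Gamma_{10}=1$, with the non-degenerate skew-symmetric spinor pairing for which the $\Gamma_a$ are skew self-adjoint; $\Gamma_{a_1\cdots a_k}$ denotes the skew-symmetrized product. Repeated indices are summed. Super-Minkowski spacetime $\mathbb{R}^{1,10|\mathbf{32}}$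 has generators $\psi^\alpha$ of bidegree $(1,\mathrm{odd})$ and $e^a$ of bidegree $(1,\mathrm{evn})$, with $\mathrm{d}\psi^\alpha=0$, $\mathrm{d}e^a=(\overline\psi\Gamma^a\psi)$. Put $$G_4=\tfrac12(\overline\psi\Gamma_{ab}\psi)e^ae^b,\qquad G_7=\tfrac1{5!}(\overline\psi\Gamma_{a_1\cdots a_5}\psi)e^{a_1}\cdots e^{a_5}.$$ Let $\mathfrak{m}2\mathfrak{brane}$ and $\mathfrak{m}2\mathfrak{brane}^-$ be the extensions of $\mathbb{R}^{1,10|\mathbf{32}}$ by one further generator $c_3$, resp. $c_3^-$, of bidegree $(3,\mathrm{evn})$ with $\mathrm{d}c_3=G_4$, resp. $\mathrm{d}c_3^-=-G_4$. Every element of either CE-algebra is uniquely $\alpha=\alpha_{\mathrm{bas}}+c\cdot p_*\alpha$ with $c=c_3$ resp. $c_3^-$ and $\alpha_{\mathrm{bas}},p_*\alpha\in\mathrm{CE}(\mathbb{R}^{1,10|\mathbf{32}})$. Put $$\widetilde G_7=2G_7-c_3G_4,\qquad \widetilde G_7^-=2G_7+c_3^-G_4 .$$ For a $7$-cocycle $H$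 on $\mathfrak{g}$ and $m\in\mathbb{Z}$, an $H$-twisted cocycle of degree $m$ mod $6$ is a homomorphism from $\mathfrak{g}$ to the algebra $\mathfrak{l}(m)$ with generators $h_7$ of bidegree $(7,\mathrm{evn})$ and $f_{6k+m}$ of bidegree $(6k+m,\mathrm{evn})$ ($k\in\mathbb{Z}$), $\mathrm{d}h_7=0$, $\mathrm{d}f_{6(k+1)+m}=h_7f_{6k+m}$, sending $h_7\mapsto H$; equivalently a family $(F_{6k+m})_{k\in\mathbb{Z}}$ with $F_{6k+m}\in\mathrm{CE}(\mathfrak{g})$ of bidegree $(6k+m,\mathrm{evn})$ and $\mathrm{d}F_{6(k+1)+m}=H\,F_{6k+m}$. The $3$-cyclification $\mathrm{cyc}_3(\mathfrak{h})$ of an algebra $\mathfrak{h}$ with generators $e^i$ has generators $\omega_4$ of bidegree $(4,\mathrm{evn})$, $e^i$, and $\mathrm{s}e^i$ of bidegree $\deg e^i-(3,\mathrm{evn})$, with $\mathrm{d}\omega_4=0$, $\mathrm{d}e^i=\mathrm{d}_{\mathfrak{h}}e^i+\omega_4\,\mathrm{s}e^i$, $\mathrm{d}\,\mathrm{s}e^i=-\mathrm{s}(\mathrm{d}_{\mathfrak{h}}e^i)$,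 where $\mathrm{s}$ is the graded derivation with $e^i\mapsto\mathrm{s}e^i$, $\mathrm{s}e^i\mapsto0$, $\omega_4\mapsto 0$. The reduction of a homomorphism $f:\widehat{\mathfrak{g}}\to\mathfrak{h}$ from the extension of $\mathfrak{g}$ by a $4$-cocycle $\omega$ is the homomorphism $\mathfrak{g}\to\mathrm{cyc}_3(\mathfrak{h})$ with $\omega_4\mapsto\omega$, $e^i\mapsto(f^*e^i)_{\mathrm{bas}}$, $\mathrm{s}e^i\mapsto-p_*f^*e^i$; the inverse operation is oxidation along $\omega$. *Higher T-duality* is the composite of reduction along the first extension, precomposition of the pullback with the map $\omega_4\mapsto-\mathrm{s}h_7$, $\mathrm{s}h_7\mapsto-\omega_4$, $h_7\mapsto h_7$ (for twists, on $\mathrm{CE}(\mathrm{cyc}_3(b^6\mathbb{R}))$, where $b^6\mathbb{R}$ has one closed generator $h_7$), extended by $f_{6k-3+m}\mapsto\mathrm{s}f_{6k+m}$, $\mathrm{s}f_{6k-3+m}\mapsto f_{6(k-1)+m}$ (for twisted cocycles, $\mathrm{CE}(\mathrm{cyc}_3\,\mathfrak{l}(m-3))\to\mathrm{CE}(\mathrm{cyc}_3\,\mathfrak{l}(m))$),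 and oxidation along the second extension. **Statement.** 1. $\mathfrak{m}2\mathfrak{brane}$ and $\mathfrak{m}2\mathfrak{brane}^-$ are super-$L_\infty$ algebras ($\mathrm{d}^2=0$); $\widetilde G_7$ and $\widetilde G_7^-$ are $7$-cocycles on them, and each is carried to the other by higher T-duality. The reflection $c_3^-\mapsto-c_3$ (identity on $\psi^\alpha$, $e^a$) defines an isomorphism $\mathfrak{m}2\mathfrak{brane}\cong\mathfrak{m}2\mathfrak{brane}^-$ whose pullback sends $\widetilde G_7^-$ to $\widetilde G_7$. 2. For every $m\in\mathbb{Z}$, higher T-duality is a bijection from $\widetilde G_7$-twisted cocycles of degree $m$ mod $6$ on $\mathfrak{m}2\mathfrak{brane}$ to $\widetilde G_7^-$-twisted cocycles of degree $m-3$ mod $6$ on $\mathfrak{m}2\mathfrak{brane}^-$, explicitly $$(F_{6k+m})_{k}\longmapsto(F'_{6k-3+m})_k,\qquad F'_{6k-3+m}=-p_*F_{6k+m}-c_3^-\,(F_{6(k-1)+m})_{\mathrm{bas}},$$ with inverse $F_{6k+m}=-p_*F'_{6(k+1)-3+m}-c_3\,(F'_{6k-3+m})_{\mathrm{bas}}$.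 Likewise, with the roles of $(\mathfrak{m}2\mathfrak{brane},\widetilde G_7,c_3)$ and $(\mathfrak{m}2\mathfrak{brane}^-,\widetilde G_7^-,c_3^-)$ exchanged. 3. Composing with the pullback along the reflection gives, for every $m$, a bijection from $\widetilde G_7$-twisted cocycles of degree $m$ mod $6$ on $\mathfrak{m}2\mathfrak{brane}$ to those of degree $m-3$ mod $6$ on $\mathfrak{m}2\mathfrak{brane}$, $$(F_{6k+m})_k\longmapsto\big(-p_*F_{6k+m}+c_3\,(F_{6(k-1)+m})_{\mathrm{bas}}\big)_k ,$$ and it is non-trivial: for some twisted cocycle $F$ of degree $m$ mod $6$, some component of its image is not a real multiple of any component of $F$. The same holds for $\widetilde G_7^-$-twisted cocycles on $\mathfrak{m}2\mathfrak{brane}^-$, with $c_3^-$ in place of $c_3$. -/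

import Mathlib

open scoped Kronecker

noncomputable section

namespace SuperLInfty

/-! ## Free graded-commutative superalgebras -/

/-- Bidegrees `(n, σ)`: homological degree and super-degree (`evn = 0`, `odd = 1`). -/
abbrev BiDeg : Type := ℤ × ZMod 2

/-- The sign `(-1)^(n₁ n₂ + σ₁ σ₂)` picked up when exchanging elements of bidegrees
`(n₁, σ₁)` and `(n₂, σ₂)`. -/
def koszul (a b : BiDeg) : ℝ :=
  (((a.1 * b.1 + ((a.2 * b.2).val : ℤ)).negOnePow : ℤˣ) : ℤ)

/-- The sign `(-1)^n` of a bidegree `(n, σ)`. -/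
def parity (a : BiDeg) : ℝ := ((a.1.negOnePow : ℤˣ) : ℤ)

/-- The relations `v_i v_j = koszul(deg_i, deg_j) v_j v_i` on the tensor algebra. -/
inductive GCA.Rel {I : Type} (deg : I → BiDeg) : FreeAlgebra ℝ I → FreeAlgebra ℝ I → Prop
  | comm (i j : I) : GCA.Rel deg (FreeAlgebra.ι ℝ i * FreeAlgebra.ι ℝ j)
      (koszul (deg i) (deg j) • (FreeAlgebra.ι ℝ j * FreeAlgebra.ι ℝ i))

/-- The graded-commutative polynomial algebra `ℝ[(v_i)_{i ∈ I}]` on generators of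
bidegrees `deg i`. -/
def GCA {I : Type} (deg : I → BiDeg) : Type := RingQuot (GCA.Rel deg)

instance {I : Type} (deg : I → BiDeg) : Ring (GCA deg) :=
  inferInstanceAs (Ring (RingQuot (GCA.Rel deg)))

instance {I : Type} (deg : I → BiDeg) : Algebra ℝ (GCA deg) :=
  inferInstanceAs (Algebra ℝ (RingQuot (GCA.Rel deg)))

namespace GCA

variable {I J : Type} {deg : I → BiDeg} {deg' : J → BiDeg}

/-- The quotient map from the tensor algebra. -/
def mk (deg : I → BiDeg) : FreeAlgebra ℝ I →ₐ[ℝ] GCA deg := RingQuot.mkAlgHom ℝ (Rel deg)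

/-- The generators. -/
def gen (deg : I → BiDeg) (i : I) : GCA deg := mk deg (FreeAlgebra.ι ℝ i)

/-- The algebra map determined by the images of the generators. -/
def lift {B : Type} [Ring B] [Algebra ℝ B] (f : I → B)
    (hf : ∀ i j, f i * f j = koszul (deg i) (deg j) • (f j * f i)) : GCA deg →ₐ[ℝ] B :=
  RingQuot.liftAlgHom ℝ ⟨FreeAlgebra.lift ℝ f, by
    rintro _ _ ⟨i, j⟩
    simpa using hf i j⟩

@[simp] theorem lift_gen {B : Type} [Ring B] [Algebra ℝ B] (f : I → B)
    (hf : ∀ i j, f i * f j = koszul (deg i) (deg j) • (f j * f i)) (i : I) :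
    lift f hf (gen deg i) = f i :=
  (RingQuot.liftAlgHom_mkAlgHom_apply ℝ _ _ _).trans (FreeAlgebra.lift_ι_apply f i)

/-- The subspace of elements of bidegree `a`: the span of the monomials in the generators of
total bidegree `a`. -/
def homog (deg : I → BiDeg) (a : BiDeg) : Submodule ℝ (GCA deg) :=
  Submodule.span ℝ {x | ∃ l : List I, (l.map deg).sum = a ∧ x = (l.map (gen deg)).prod}

theorem koszul_add_left (a b c : BiDeg) : koszul (a + b) c = koszul a c * koszul b c := by
  obtain ⟨a, s⟩ := a
  obtain ⟨b, t⟩ := b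
  obtain ⟨c, u⟩ := c
  simp only [koszul, Prod.mk_add_mk]
  rw [← Int.cast_mul, ← Units.val_mul, ← Int.negOnePow_add]
  congr 2
  rw [Int.negOnePow_eq_iff]
  have h : Even ((((s + t) * u).val : ℤ) - ((s * u).val + (t * u).val)) := by
    revert s t u; decide
  have e : (a + b) * c + (((s + t) * u).val : ℤ)
      - (a * c + ((s * u).val : ℤ) + (b * c + ((t * u).val : ℤ)))
      = (((s + t) * u).val : ℤ) - ((s * u).val + (t * u).val) := by ring
  rw [e]; exact h

theorem koszul_symm (a b : BiDeg) : koszul a b = koszul b a := by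
  simp only [koszul, mul_comm]

theorem koszul_add_right (a b c : BiDeg) : koszul a (b + c) = koszul a b * koszul a c := by
  rw [koszul_symm, koszul_add_left, koszul_symm b, koszul_symm c]

theorem koszul_zero_left (a : BiDeg) : koszul 0 a = 1 := by simp [koszul]

theorem koszul_zero_right (a : BiDeg) : koszul a 0 = 1 := by simp [koszul]

theorem koszul_mul_self (a b : BiDeg) : koszul a b * koszul a b = 1 := by
  simp only [koszul]
  rw [← Int.cast_mul, ← Units.val_mul, Int.units_mul_self]; simp

theorem koszul_odd (a : BiDeg) {k : ℤ} (hk : Odd k) : koszul a (k, 0) = parity a := by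
  simp only [koszul, parity, mul_zero, ZMod.val_zero, Nat.cast_zero, add_zero]
  congr 2
  rw [Int.negOnePow_eq_iff]
  have : a.1 * k - a.1 = a.1 * (k - 1) := by ring
  rw [this]
  exact (hk.sub_odd odd_one).mul_left _

theorem parity_mul_self (a : BiDeg) : parity a * parity a = 1 := by
  rw [← koszul_odd a odd_one, koszul_mul_self]

theorem gen_mul_gen (i j : I) :
    gen deg i * gen deg j = koszul (deg i) (deg j) • (gen deg j * gen deg i) := by
  have h : mk deg (FreeAlgebra.ι ℝ i * FreeAlgebra.ι ℝ j)
      = mk deg (koszul (deg i) (deg j) • (FreeAlgebra.ι ℝ j * FreeAlgebra.ι ℝ i)) :=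
    RingQuot.mkAlgHom_rel ℝ (Rel.comm (deg := deg) i j)
  rwa [map_smul, map_mul, map_mul] at h

theorem gen_mem (i : I) : gen deg i ∈ homog deg (deg i) :=
  Submodule.subset_span ⟨[i], by simp, by simp⟩

theorem one_homog : (1 : GCA deg) ∈ homog deg 0 :=
  Submodule.subset_span ⟨[], by simp, by simp⟩

theorem mul_homog {a b : BiDeg} {x y : GCA deg} (hx : x ∈ homog deg a) (hy : y ∈ homog deg b) :
    x * y ∈ homog deg (a + b) := by
  induction hx using Submodule.span_induction with
  | mem x hx =>
    obtain ⟨l, rfl, rfl⟩ := hx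
    induction hy using Submodule.span_induction with
    | mem y hy =>
      obtain ⟨l', rfl, rfl⟩ := hy
      exact Submodule.subset_span ⟨l ++ l', by simp, by simp⟩
    | zero => simp
    | add y z _ _ h1 h2 => rw [mul_add]; exact add_mem h1 h2
    | smul r y _ h => rw [mul_smul_comm]; exact Submodule.smul_mem _ _ h
  | zero => simp
  | add y z _ _ h1 h2 => rw [add_mul]; exact add_mem h1 h2
  | smul r y _ h => rw [smul_mul_assoc]; exact Submodule.smul_mem _ _ h

theorem gen_mul_mono (i : I) (l : List I) :
    gen deg i * (l.map (gen deg)).prod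
      = koszul (deg i) (l.map deg).sum • ((l.map (gen deg)).prod * gen deg i) := by
  induction l with
  | nil => simp [koszul_zero_right]
  | cons j l ih =>
    simp only [List.map_cons, List.prod_cons, List.sum_cons, koszul_add_right]
    rw [← mul_assoc, gen_mul_gen, smul_mul_assoc, mul_assoc, ih, mul_smul_comm, smul_smul,
      mul_assoc]

theorem mono_mul_mono (l l' : List I) :
    (l.map (gen deg)).prod * (l'.map (gen deg)).prod
      = koszul (l.map deg).sum (l'.map deg).sum •
        ((l'.map (gen deg)).prod * (l.map (gen deg)).prod) := by
  induction l with
  | nil => simp [koszul_zero_left]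
  | cons i l ih =>
    simp only [List.map_cons, List.prod_cons, List.sum_cons, koszul_add_left]
    rw [mul_assoc, ih, mul_smul_comm, ← mul_assoc, gen_mul_mono, smul_mul_assoc, smul_smul,
      mul_assoc, mul_comm (koszul _ _)]

/-- Homogeneous elements commute up to the Koszul sign. -/
theorem homog_comm {a b : BiDeg} {x y : GCA deg} (hx : x ∈ homog deg a)
    (hy : y ∈ homog deg b) : x * y = koszul a b • (y * x) := by
  induction hx using Submodule.span_induction with
  | mem x hx =>
    obtain ⟨l, rfl, rfl⟩ := hx
    induction hy using Submodule.span_induction with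
    | mem y hy =>
      obtain ⟨l', rfl, rfl⟩ := hy
      exact mono_mul_mono l l'
    | zero => simp
    | add y z _ _ h1 h2 => rw [mul_add, h1, h2, add_mul, smul_add]
    | smul r y _ h => rw [mul_smul_comm, h, smul_mul_assoc, smul_comm]
  | zero => simp
  | add y z _ _ h1 h2 => rw [add_mul, h1, h2, mul_add, smul_add]
  | smul r y _ h => rw [smul_mul_assoc, h, mul_smul_comm, smul_comm]

/-- The algebra map sending the generators to given elements of the same bidegree. -/
def map (f : I → GCA deg') (hf : ∀ i, f i ∈ homog deg' (deg i)) : GCA deg →ₐ[ℝ] GCA deg' :=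
  lift f fun i j => homog_comm (hf i) (hf j)

@[simp] theorem map_gen (f : I → GCA deg') (hf : ∀ i, f i ∈ homog deg' (deg i)) (i : I) :
    map f hf (gen deg i) = f i := lift_gen _ _ i

theorem algHom_mem (φ : GCA deg →ₐ[ℝ] GCA deg')
    (h : ∀ i, φ (gen deg i) ∈ homog deg' (deg i)) {a : BiDeg} {x : GCA deg}
    (hx : x ∈ homog deg a) : φ x ∈ homog deg' a := by
  induction hx using Submodule.span_induction with
  | mem x hx =>
    obtain ⟨l, rfl, rfl⟩ := hx
    induction l with
    | nil => simpa using one_homog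
    | cons i l ih => simpa using mul_homog (h i) ih
  | zero => simp
  | add y z _ _ h1 h2 => rw [map_add]; exact add_mem h1 h2
  | smul r y _ h => rw [map_smul]; exact Submodule.smul_mem _ _ h

theorem map_mem (f : I → GCA deg') (hf : ∀ i, f i ∈ homog deg' (deg i)) {a : BiDeg}
    {x : GCA deg} (hx : x ∈ homog deg a) : map f hf x ∈ homog deg' a :=
  algHom_mem _ (fun i => by rw [map_gen]; exact hf i) hx

theorem induction {C : GCA deg → Prop} (algebraMap : ∀ r : ℝ, C (algebraMap ℝ _ r))
    (gen : ∀ i, C (gen deg i)) (mul : ∀ x y, C x → C y → C (x * y))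
    (add : ∀ x y, C x → C y → C (x + y)) (x : GCA deg) : C x := by
  obtain ⟨y, rfl⟩ : ∃ y, mk deg y = x := RingQuot.mkAlgHom_surjective ℝ (Rel deg) x
  induction y using FreeAlgebra.induction with
  | grade0 r => simpa using algebraMap r
  | grade1 i => exact gen i
  | mul a b ha hb => rw [map_mul]; exact mul _ _ ha hb
  | add a b ha hb => rw [map_add]; exact add _ _ ha hb

/-- The grading involution `x ↦ (-1)^n x` for `x` of bidegree `(n, σ)`. -/
def invol (deg : I → BiDeg) : GCA deg →ₐ[ℝ] GCA deg :=
  map (fun i => parity (deg i) • gen deg i) fun i => Submodule.smul_mem _ _ (gen_mem i)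

@[simp] theorem invol_gen (i : I) : invol deg (gen deg i) = parity (deg i) • gen deg i := by
  simp [invol]

/-! ### Odd graded derivations

Let `φ = map f hf` be the algebra map with values `f i` on generators, and `v i` elements of
bidegree `deg i + (k, evn)` with `k` odd. The graded derivation `D` of degree `(k, evn)` along `φ`
with `D (gen i) = v i`, i.e. `D (x y) = D x · φ y + (-1)^|x| φ x · D y`, is the upper right
corner of the algebra map `x ↦ !![φ ((-1)^|x| x), D x; 0, φ x]`. -/

section OddDer

variable (f : I → GCA deg') (hf : ∀ i, f i ∈ homog deg' (deg i)) (k : ℤ) (hk : Odd k)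
  (v : I → GCA deg') (hv : ∀ i, v i ∈ homog deg' (deg i + (k, 0)))

/-- The algebra map into upper triangular matrices encoding an odd derivation. -/
def oddDerMat : GCA deg →ₐ[ℝ] Matrix (Fin 2) (Fin 2) (GCA deg') :=
  lift (fun i => !![parity (deg i) • f i, v i; 0, f i]) fun i j => by
    have h1 := homog_comm (hf i) (hf j)
    have h2 := homog_comm (hf i) (hv j)
    have h3 := homog_comm (hv i) (hf j)
    rw [koszul_add_right, koszul_odd _ hk] at h2
    rw [koszul_add_left, koszul_symm (k, 0), koszul_odd _ hk] at h3
    have pi := parity_mul_self (deg i)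
    ext a b
    fin_cases a <;> fin_cases b
    · simp [Matrix.mul_apply, h1, smul_smul]
      ring_nf
    · have e : parity (deg i) * (koszul (deg i) (deg j) * parity (deg i))
          = koszul (deg i) (deg j) := by
        rw [mul_left_comm, pi, mul_one]
      simp [Matrix.mul_apply, h2, h3, smul_smul, e, smul_add, add_comm]
    · simp [Matrix.mul_apply]
    · simp [Matrix.mul_apply, h1]

/-- The odd derivation `D`. -/
def oddDer : GCA deg →ₗ[ℝ] GCA deg' where
  toFun x := oddDerMat f hf k hk v hv x 0 1
  map_add' x y := by simp
  map_smul' r x := by simp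

@[simp] theorem oddDer_gen (i : I) : oddDer f hf k hk v hv (gen deg i) = v i := by
  simp [oddDer, oddDerMat]

theorem oddDerMat_apply (x : GCA deg) :
    oddDerMat f hf k hk v hv x =
      !![map f hf (invol deg x), oddDer f hf k hk v hv x; 0, map f hf x] := by
  have key : oddDerMat f hf k hk v hv x 0 0 = map f hf (invol deg x) ∧
      oddDerMat f hf k hk v hv x 1 0 = 0 ∧ oddDerMat f hf k hk v hv x 1 1 = map f hf x := by
    induction x using GCA.induction with
    | algebraMap r => simp [Matrix.algebraMap_eq_diagonal, AlgHom.commutes]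
    | gen i => simp [oddDerMat, invol]
    | mul x y hx hy =>
      simp [Matrix.mul_apply, hx.1, hx.2.1, hx.2.2, hy.1, hy.2.1, hy.2.2]
    | add x y hx hy =>
      simp [hx.1, hx.2.1, hx.2.2, hy.1, hy.2.1, hy.2.2]
  ext a b
  fin_cases a <;> fin_cases b
  · exact key.1
  · rfl
  · exact key.2.1
  · exact key.2.2

/-- The graded Leibniz rule. -/
theorem oddDer_mul (x y : GCA deg) :
    oddDer f hf k hk v hv (x * y) =
      oddDer f hf k hk v hv x * map f hf y + map f hf (invol deg x) * oddDer f hf k hk v hv y := by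
  have h : oddDer f hf k hk v hv (x * y) = oddDerMat f hf k hk v hv (x * y) 0 1 := rfl
  rw [h, map_mul, oddDerMat_apply, oddDerMat_apply]
  simp [Matrix.mul_apply, add_comm]

theorem invol_of_mem {a : BiDeg} {x : GCA deg} (hx : x ∈ homog deg a) :
    invol deg x = parity a • x := by
  induction hx using Submodule.span_induction with
  | mem x hx =>
    obtain ⟨l, rfl, rfl⟩ := hx
    induction l with
    | nil => simp [parity]
    | cons i l ih =>
      have : parity (deg i + (l.map deg).sum) = parity (deg i) * parity (l.map deg).sum := by
        rw [← koszul_odd _ odd_one, ← koszul_odd _ odd_one, ← koszul_odd _ odd_one,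
          koszul_add_left]
      simp only [List.map_cons, List.prod_cons, List.sum_cons, map_mul, ih, this, invol_gen,
        smul_mul_assoc, mul_smul_comm, smul_smul, mul_comm (parity (List.map deg l).sum)]
  | zero => simp
  | add y z _ _ h1 h2 => rw [map_add, h1, h2, smul_add]
  | smul r y _ h => rw [map_smul, h, smul_comm]

theorem oddDer_one : oddDer f hf k hk v hv 1 = 0 := by
  have h : oddDer f hf k hk v hv 1 = oddDerMat f hf k hk v hv 1 0 1 := rfl
  simp [h]

theorem oddDer_mem {a : BiDeg} {x : GCA deg} (hx : x ∈ homog deg a) :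
    oddDer f hf k hk v hv x ∈ homog deg' (a + (k, 0)) := by
  induction hx using Submodule.span_induction with
  | mem x hx =>
    obtain ⟨l, rfl, rfl⟩ := hx
    induction l with
    | nil => simp [oddDer_one]
    | cons i l ih =>
      have hl : (l.map (gen deg)).prod ∈ homog deg (l.map deg).sum :=
        Submodule.subset_span ⟨l, rfl, rfl⟩
      simp only [List.map_cons, List.prod_cons, List.sum_cons, oddDer_mul, oddDer_gen]
      refine add_mem ?_ ?_
      · rw [add_right_comm]
        exact mul_homog (hv i) (map_mem f hf hl)
      · rw [add_assoc, invol_of_mem (gen_mem i), map_smul, smul_mul_assoc, map_gen]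
        exact Submodule.smul_mem _ _ (mul_homog (hf i) ih)
  | zero => simp
  | add y z _ _ h1 h2 => rw [map_add]; exact add_mem h1 h2
  | smul r y _ h => rw [map_smul]; exact Submodule.smul_mem _ _ h

end OddDer

end GCA

open GCA

/-! ## Super-`L_∞` algebras through their Chevalley–Eilenberg algebras -/

/-- A presentation `ℝ_d[(t^i)_i] / (d t^i = P^i)`: bigraded generators with prescribed
differentials `P^i` of bidegree `deg i + (1, evn)`. It is the Chevalley–Eilenberg algebra of a
super-`L_∞` algebra if the resulting derivation squares to zero, see `IsSuperLInfty`. -/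
structure Presentation where
  /-- the generators `t^i` -/
  Gen : Type
  /-- their bidegrees -/
  deg : Gen → BiDeg
  /-- their differentials `P^i` -/
  diff : Gen → GCA deg
  diff_mem : ∀ i, diff i ∈ homog deg (deg i + (1, 0))

namespace Presentation

/-- The underlying graded-commutative superalgebra of the Chevalley–Eilenberg algebra. -/
abbrev CE (g : Presentation) : Type := GCA g.deg

/-- The generators, as elements of the Chevalley–Eilenberg algebra. -/
abbrev gen (g : Presentation) (i : g.Gen) : g.CE := GCA.gen g.deg i

/-- The elements of bidegree `a`. -/
abbrev homog (g : Presentation) (a : BiDeg) : Submodule ℝ g.CE := GCA.homog g.deg a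

/-- The differential: the graded derivation of degree `(1, evn)` with `d t^i = P^i`. -/
def d (g : Presentation) : g.CE →ₗ[ℝ] g.CE :=
  oddDer (GCA.gen g.deg) gen_mem 1 odd_one g.diff g.diff_mem

/-- The consistency condition `d ∘ d = 0`. -/
def IsSuperLInfty (g : Presentation) : Prop := ∀ x : g.CE, g.d (g.d x) = 0

/-- Homomorphisms `g → h` of super-`L_∞` algebras: homomorphisms `CE(h) → CE(g)` of
differential bigraded algebras. -/
structure Hom (g h : Presentation) where
  /-- the pullback `CE(h) → CE(g)` -/
  pull : h.CE →ₐ[ℝ] g.CE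
  pull_mem : ∀ (a : BiDeg) (x : h.CE), x ∈ h.homog a → pull x ∈ g.homog a
  pull_d : ∀ x : h.CE, pull (h.d x) = g.d (pull x)

/-! ### Higher central extensions by even cocycles -/

section Ext

variable (g : Presentation) (t : ℤ) (ω : g.CE) (hω : ω ∈ g.homog (2 * t, 0))

/-- Bidegrees of the generators of the extension: the new generator `none` has bidegree
`(2t - 1, evn)`. -/
def extDeg : Option g.Gen → BiDeg
  | none => (2 * t - 1, 0)
  | some i => g.deg i

/-- The inclusion `p^* : CE(g) → CE(ĝ)` of basic elements. -/
def basicIncl : g.CE →ₐ[ℝ] GCA (extDeg g t) :=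
  GCA.map (deg := g.deg) (fun i => GCA.gen (extDeg g t) (some i)) fun i => gen_mem (deg := extDeg g t) (some i)

@[simp] theorem basicIncl_gen (i : g.Gen) :
    basicIncl g t (g.gen i) = GCA.gen (extDeg g t) (some i) := map_gen _ _ i

theorem basicIncl_mem {a : BiDeg} {x : g.CE} (hx : x ∈ g.homog a) :
    basicIncl g t x ∈ GCA.homog (extDeg g t) a := GCA.map_mem _ _ hx

/-- The values on generators of the projection onto the basic part. -/
def basVal : Option g.Gen → g.CE
  | none => 0
  | some i => g.gen i

theorem basVal_mem : ∀ i, basVal g i ∈ g.homog (extDeg g t i)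
  | none => zero_mem _
  | some i => gen_mem i

/-- The values on generators of fiber integration. -/
def fibVal : Option g.Gen → g.CE
  | none => 1
  | some _ => 0

theorem fibVal_mem : ∀ i, fibVal g i ∈ g.homog (extDeg g t i + (-(2 * t - 1), 0))
  | none => by
    have e : extDeg g t none + (-(2 * t - 1), 0) = 0 := by simp [extDeg]
    rw [e]
    exact one_homog
  | some i => zero_mem _

theorem odd_aux : Odd (-(2 * t - 1)) := ⟨-t, by ring⟩

/-- The basic part `α_bas ∈ CE(g)` of `α ∈ CE(ĝ)`. -/
def basicPart : GCA (extDeg g t) →ₐ[ℝ] g.CE :=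
  GCA.map (basVal g) (basVal_mem g t)

/-- Fiber integration `p_* : CE(ĝ) → CE(g)`: the graded derivation of degree
`(-(2t - 1), evn)` with `b ↦ 1` and vanishing on the generators of `CE(g)`. -/
def fiberInt : GCA (extDeg g t) →ₗ[ℝ] g.CE :=
  oddDer (basVal g) (basVal_mem g t) (-(2 * t - 1)) (odd_aux t) (fibVal g) (fibVal_mem g t)

theorem fiberInt_mul (x y : GCA (extDeg g t)) :
    fiberInt g t (x * y) = fiberInt g t x * basicPart g t y
      + basicPart g t (invol _ x) * fiberInt g t y :=
  oddDer_mul _ _ _ _ _ _ x y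

theorem basicIncl_mul_gen (x : g.CE) :
    basicIncl g t x * GCA.gen (extDeg g t) none
      = GCA.gen (extDeg g t) none * basicIncl g t (invol g.deg x) := by
  induction x using GCA.induction with
  | algebraMap r => simp only [AlgHom.commutes, Algebra.commutes]
  | gen i =>
    have h := gen_mul_gen (deg := extDeg g t) (some i) none
    have e : koszul (extDeg g t (some i)) (extDeg g t none) = parity (g.deg i) :=
      koszul_odd (g.deg i) (k := 2 * t - 1) ⟨t - 1, by ring⟩
    rw [e] at h
    simpa using h
  | mul x y hx hy =>
    rw [map_mul, mul_assoc, hy, ← mul_assoc, hx, map_mul, map_mul, mul_assoc]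
  | add x y hx hy => rw [map_add, add_mul, hx, hy, map_add, map_add, mul_add]

theorem gen_none_sq : GCA.gen (extDeg g t) none * GCA.gen (extDeg g t) none = 0 := by
  have h := gen_mul_gen (deg := extDeg g t) none none
  have e : koszul (extDeg g t none) (extDeg g t none) = -1 := by
    have h1 : koszul (extDeg g t none) (extDeg g t none) = parity (extDeg g t none) :=
      koszul_odd _ (k := 2 * t - 1) ⟨t - 1, by ring⟩
    have ho : Odd (2 * t - 1) := ⟨t - 1, by ring⟩
    rw [h1]
    simp [parity, extDeg, Int.negOnePow_odd _ ho]
  rw [e] at h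
  have h2 : (2 : ℝ) • (GCA.gen (extDeg g t) none * GCA.gen (extDeg g t) none) = 0 := by
    rw [two_smul]
    nth_rewrite 1 [h]
    module
  exact (smul_eq_zero.mp h2).resolve_left two_ne_zero

theorem basicPart_invol (x : GCA (extDeg g t)) :
    basicPart g t (invol _ x) = invol g.deg (basicPart g t x) := by
  induction x using GCA.induction with
  | algebraMap r => simp only [AlgHom.commutes]
  | gen i =>
    cases i with
    | none => simp [basicPart, basVal]
    | some i => simp [basicPart, basVal, extDeg]
  | mul x y hx hy => simp only [map_mul, hx, hy]
  | add x y hx hy => simp only [map_add, hx, hy]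

/-- The decomposition `α = α_bas + b · p_* α`. -/
theorem basic_add_fiber (α : GCA (extDeg g t)) :
    α = basicIncl g t (basicPart g t α)
      + GCA.gen (extDeg g t) none * basicIncl g t (fiberInt g t α) := by
  induction α using GCA.induction with
  | algebraMap r =>
    have h : fiberInt g t (algebraMap ℝ _ r) = 0 := by
      rw [Algebra.algebraMap_eq_smul_one, map_smul, fiberInt, oddDer_one, smul_zero]
    rw [h, AlgHom.commutes, AlgHom.commutes, map_zero, mul_zero, add_zero]
  | gen i =>
    cases i with
    | none => simp [basicPart, fiberInt, basVal, fibVal]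
    | some i => simp [basicPart, fiberInt, basVal, fibVal]
  | mul x y hx hy =>
    have hb := basicIncl_mul_gen g t
    rw [fiberInt_mul, basicPart_invol]
    conv_lhs => rw [hx, hy]
    simp only [map_mul, map_add, mul_add, add_mul]
    have hbb := gen_none_sq g t
    generalize GCA.gen (extDeg g t) none = b at *
    rw [← mul_assoc (basicIncl g t (basicPart g t x)) b, hb]
    have : b * basicIncl g t (fiberInt g t x) * (b * basicIncl g t (fiberInt g t y)) = 0 := by
      rw [mul_assoc, ← mul_assoc _ b, hb, ← mul_assoc, ← mul_assoc, hbb, zero_mul, zero_mul]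
    rw [this]
    noncomm_ring
  | add x y hx hy =>
    conv_lhs => rw [hx, hy]
    simp only [map_add, mul_add]
    abel

/-- Differentials of the generators of the extension. -/
def extDiff : Option g.Gen → GCA (extDeg g t)
  | none => basicIncl g t ω
  | some i => basicIncl g t (g.diff i)

/-- The higher central extension `ĝ` of `g` classified by the `2t`-cocycle `ω`:
`CE(ĝ) = CE(g)[b] / (d b = ω)` with `b` of bidegree `(2t - 1, evn)`. -/
abbrev ext : Presentation where
  Gen := Option g.Gen
  deg := extDeg g t
  diff := extDiff g t ω
  diff_mem
    | none => by
      have e : extDeg g t none + (1, 0) = (2 * t, 0) := by simp [extDeg]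
      rw [e]
      exact basicIncl_mem g t hω
    | some i => basicIncl_mem g t (g.diff_mem i)

/-- The inclusion `p^* : CE(g) → CE(ĝ)`. -/
abbrev extIncl : g.CE →ₐ[ℝ] (g.ext t ω hω).CE := basicIncl g t

/-- The extending generator `b`. -/
abbrev extGen : (g.ext t ω hω).CE := (g.ext t ω hω).gen none

/-- The basic part `α_bas ∈ CE(g)` of `α ∈ CE(ĝ)`. -/
abbrev bas : (g.ext t ω hω).CE →ₐ[ℝ] g.CE := basicPart g t

/-- Fiber integration `p_* : CE(ĝ) → CE(g)`. -/
abbrev fib : (g.ext t ω hω).CE →ₗ[ℝ] g.CE := fiberInt g t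

end Ext

/-! ### Higher cyclification -/

section Cyc

/-- Generators of the cyclification: `ω_{2t}`, `e^i` and `s_t e^i`. -/
inductive CycGen (I : Type) : Type
  | omega : CycGen I
  | base : I → CycGen I
  | shift : I → CycGen I

variable (h : Presentation) (t : ℤ)

/-- Bidegrees of the generators of the cyclification. -/
def cycDeg : CycGen h.Gen → BiDeg
  | .omega => (2 * t, 0)
  | .base i => h.deg i
  | .shift i => h.deg i + (-(2 * t - 1), 0)

/-- The inclusion of graded algebras `CE(h) → CE(cyc h)`, `e^i ↦ e^i` (not a chain map). -/
def cycIncl : h.CE →ₐ[ℝ] GCA (cycDeg h t) :=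
  GCA.map (deg := h.deg) (fun i => GCA.gen (cycDeg h t) (.base i))
    fun i => gen_mem (deg := cycDeg h t) (.base i)

/-- The shift derivation `s_t` of degree `(-(2t - 1), evn)`, restricted to `CE(h)`:
`e^i ↦ s_t e^i`. -/
def cycShift : h.CE →ₗ[ℝ] GCA (cycDeg h t) :=
  oddDer (deg := h.deg) (fun i => GCA.gen (cycDeg h t) (.base i))
    (fun i => gen_mem (deg := cycDeg h t) (.base i)) (-(2 * t - 1)) (odd_aux t)
    (fun i => GCA.gen (cycDeg h t) (.shift i))
    (fun i => gen_mem (deg := cycDeg h t) (.shift i))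

/-- Differentials of the generators of the cyclification. -/
def cycDiff : CycGen h.Gen → GCA (cycDeg h t)
  | .omega => 0
  | .base i => cycIncl h t (h.diff i)
      + GCA.gen (cycDeg h t) .omega * GCA.gen (cycDeg h t) (.shift i)
  | .shift i => - cycShift h t (h.diff i)

/-- The `(2t - 1)`-cyclification of `h`: `d ω = 0`, `d e^i = d_h e^i + ω · s_t e^i`,
`d (s_t e^i) = - s_t (d_h e^i)`. -/
abbrev cyc : Presentation where
  Gen := CycGen h.Gen
  deg := cycDeg h t
  diff := cycDiff h t
  diff_mem
    | .omega => zero_mem _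
    | .base i => by
      refine add_mem (GCA.map_mem _ _ (h.diff_mem i)) ?_
      have := mul_homog (gen_mem (deg := cycDeg h t) .omega)
        (gen_mem (deg := cycDeg h t) (.shift i))
      have e : cycDeg h t .omega + cycDeg h t (.shift i) = cycDeg h t (.base i) + (1, 0) := by
        ext
        · simp [cycDeg]; ring
        · simp [cycDeg]
      rwa [e] at this
    | .shift i => by
      refine neg_mem ?_
      have := oddDer_mem (fun i => GCA.gen (cycDeg h t) (.base i))
        (fun i => gen_mem (deg := cycDeg h t) (.base i)) (-(2 * t - 1)) (odd_aux t)
        (fun i => GCA.gen (cycDeg h t) (.shift i))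
        (fun i => gen_mem (deg := cycDeg h t) (.shift i)) (h.diff_mem i)
      have e : h.deg i + (1, 0) + (-(2 * t - 1), 0) = cycDeg h t (.shift i) + (1, 0) := by
        simp only [cycDeg]; abel
      rwa [e] at this

/-- The generator `ω_{2t}` of the cyclification. -/
abbrev cycOmega : (h.cyc t).CE := (h.cyc t).gen CycGen.omega

/-- The generator `e^i` of the cyclification. -/
abbrev cycBase (i : h.Gen) : (h.cyc t).CE := (h.cyc t).gen (CycGen.base i)

/-- The generator `s_t e^i` of the cyclification. -/
abbrev cycShiftGen (i : h.Gen) : (h.cyc t).CE := (h.cyc t).gen (CycGen.shift i)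

variable {h t}

/-- `r : g → cyc_{2t-1}(h)` is the reduction `rdc_ω(f)` of `f : ĝ → h`, equivalently
`f = oxd_ω(r)`: it sends `ω_{2t} ↦ ω`, `e^i ↦ (f^* e^i)_bas` and `s_t e^i ↦ - p_*(f^* e^i)`. -/
def IsReduction {g : Presentation} {ω : g.CE} {hω : ω ∈ g.homog (2 * t, 0)}
    (f : Hom (g.ext t ω hω) h) (r : Hom g (h.cyc t)) : Prop :=
  r.pull (cycOmega h t) = ω ∧
  (∀ i, r.pull (cycBase h t i) = g.bas t ω hω (f.pull (h.gen i))) ∧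
  (∀ i, r.pull (cycShiftGen h t i) = - g.fib t ω hω (f.pull (h.gen i)))

end Cyc

end Presentation

open Presentation

/-! ## Classifying algebras -/

/-- The line Lie algebra `b^n ℝ`: one closed generator of bidegree `(n + 1, evn)`. -/
abbrev lineAlg (n : ℤ) : Presentation where
  Gen := Unit
  deg := fun _ => (n + 1, 0)
  diff := fun _ => 0
  diff_mem := fun _ => zero_mem _

/-- The generator `ω_{n+1}` of `CE(b^n ℝ)`. -/
abbrev lineGen (n : ℤ) : (lineAlg n).CE := (lineAlg n).gen ()

/-- Bidegrees of the generators of `twistAlg`. -/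
def twistDeg (n m : ℤ) : Option ℤ → BiDeg
  | none => (2 * n + 1, 0)
  | some k => (2 * n * k + m, 0)

/-- Differentials of the generators of `twistAlg`. -/
def twistDiff (n m : ℤ) : Option ℤ → GCA (twistDeg n m)
  | none => 0
  | some k => GCA.gen (twistDeg n m) none * GCA.gen (twistDeg n m) (some (k - 1))

theorem twistDiff_mem (n m : ℤ) : ∀ i, twistDiff n m i ∈
    GCA.homog (twistDeg n m) (twistDeg n m i + (1, 0)) := by
  rintro (_ | k)
  · rw [twistDiff]
    exact Submodule.zero_mem _
  · have h := mul_homog (gen_mem (deg := twistDeg n m) none)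
      (gen_mem (deg := twistDeg n m) (some (k - 1)))
    have e : twistDeg n m none + twistDeg n m (some (k - 1))
        = twistDeg n m (some k) + (1, 0) := by
      ext
      · simp [twistDeg]; ring
      · simp [twistDeg]
    rw [e] at h
    exact h

/-- The super-`L_∞` algebra `𝔩(Σ^m K^n U ⫽ B^{2n-1}U(1))` classifying `(2n+1)`-twisted cocycles
of degree `m` mod `2n`: generators `h_{2n+1}` and `f_{2nk+m}` (`k ∈ ℤ`), with `d h_{2n+1} = 0` and
`d f_{2n(k+1)+m} = h_{2n+1} f_{2nk+m}`. -/
abbrev twistAlg (n m : ℤ) : Presentation where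
  Gen := Option ℤ
  deg := twistDeg n m
  diff := twistDiff n m
  diff_mem := twistDiff_mem n m

/-- The generator `h_{2n+1}`. -/
abbrev twistH (n m : ℤ) : (twistAlg n m).CE := (twistAlg n m).gen none

/-- The generator `f_{2nk+m}`. -/
abbrev twistF (n m k : ℤ) : (twistAlg n m).CE := (twistAlg n m).gen (some k)

/-- The `H`-twisted cocycles of degree `m` mod `6` on `g`, for `H ∈ CE(g)` of bidegree
`(7, evn)`: homomorphisms from `g` to the classifying algebra with `h_7 ↦ H`. -/
def TwistedCocycle (g : Presentation) (H : g.CE) (m : ℤ) : Type :=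
  {F : Hom g (twistAlg 3 m) // F.pull (twistH 3 m) = H}

/-- The component `F_{6k+m}` of a twisted cocycle. -/
def TwistedCocycle.comp {g : Presentation} {H : g.CE} {m : ℤ} (F : TwistedCocycle g H m)
    (k : ℤ) : g.CE :=
  F.1.pull (twistF 3 m k)

/-! ## The isomorphisms of 3-cyclifications -/

/-- The automorphism of `b𝒯₂ = cyc₃(b^6 ℝ)`:
`ω₄ ↦ - s h₇`, `s h₇ ↦ - ω₄`, `h₇ ↦ h₇`. -/
def twistSwap : ((lineAlg 6).cyc 2).CE →ₐ[ℝ] ((lineAlg 6).cyc 2).CE :=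
  GCA.map
    (fun
      | .omega => - cycShiftGen (lineAlg 6) 2 ()
      | .base _ => cycBase (lineAlg 6) 2 ()
      | .shift _ => - cycOmega (lineAlg 6) 2)
    (fun
      | .omega => neg_mem (gen_mem (deg := cycDeg (lineAlg 6) 2) (.shift ()))
      | .base _ => gen_mem (deg := cycDeg (lineAlg 6) 2) (.base ())
      | .shift _ => neg_mem (gen_mem (deg := cycDeg (lineAlg 6) 2) .omega))

/-- The values on generators of `cocycleSwap`. -/
def cocycleSwapVal (m : ℤ) : CycGen (Option ℤ) → ((twistAlg 3 m).cyc 2).CE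
  | .omega => - cycShiftGen (twistAlg 3 m) 2 none
  | .base none => cycBase (twistAlg 3 m) 2 none
  | .base (some k) => cycShiftGen (twistAlg 3 m) 2 (some k)
  | .shift none => - cycOmega (twistAlg 3 m) 2
  | .shift (some k) => cycBase (twistAlg 3 m) 2 (some (k - 1))

theorem cocycleSwapVal_mem (m : ℤ) : ∀ i, cocycleSwapVal m i ∈
    ((twistAlg 3 m).cyc 2).homog (cycDeg (twistAlg 3 (m - 3)) 2 i)
  | .omega => neg_mem (gen_mem (deg := cycDeg (twistAlg 3 m) 2) (.shift none))
  | .base none => gen_mem (deg := cycDeg (twistAlg 3 m) 2) (.base none)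
  | .base (some k) => by
    have := gen_mem (deg := cycDeg (twistAlg 3 m) 2) (.shift (some k))
    have e : cycDeg (twistAlg 3 m) 2 (.shift (some k))
        = cycDeg (twistAlg 3 (m - 3)) 2 (.base (some k)) := by
      ext
      · simp [cycDeg, twistDeg]; ring
      · simp [cycDeg, twistDeg]
    rwa [e] at this
  | .shift none => neg_mem (gen_mem (deg := cycDeg (twistAlg 3 m) 2) .omega)
  | .shift (some k) => by
    have := gen_mem (deg := cycDeg (twistAlg 3 m) 2) (.base (some (k - 1)))
    have e : cycDeg (twistAlg 3 m) 2 (.base (some (k - 1)))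
        = cycDeg (twistAlg 3 (m - 3)) 2 (.shift (some k)) := by
      ext
      · simp [cycDeg, twistDeg]; ring
      · simp [cycDeg, twistDeg]
    rwa [e] at this

/-- The isomorphism of the 3-cyclifications of the classifying algebras in degrees `m` and `m - 3`,
as a map `CE(cyc₃ 𝔩(Σ^{m-3}…)) → CE(cyc₃ 𝔩(Σ^m…))`: it extends `twistSwap` by
`f_{6k-3+m} ↦ s f_{6k+m}` and `s f_{6k-3+m} ↦ f_{6(k-1)+m}`. -/
def cocycleSwap (m : ℤ) :
    ((twistAlg 3 (m - 3)).cyc 2).CE →ₐ[ℝ] ((twistAlg 3 m).cyc 2).CE :=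
  GCA.map (cocycleSwapVal m) (cocycleSwapVal_mem m)

/-- The twisting 7-cocycle `H'` on the extension of `g` by `ω'` arises from the twisting 7-cocycle
`H` on the extension of `g` by `ω` through reduction along `ω`, the automorphism of `b𝒯₂`, and
oxidation along `ω'`. -/
def TwistsTDual {g : Presentation} {ω ω' : g.CE} {hω : ω ∈ g.homog (2 * 2, 0)}
    {hω' : ω' ∈ g.homog (2 * 2, 0)} (H : Hom (g.ext 2 ω hω) (lineAlg 6))
    (H' : Hom (g.ext 2 ω' hω') (lineAlg 6)) : Prop :=
  ∃ r r' : Hom g ((lineAlg 6).cyc 2),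
    IsReduction H r ∧ r'.pull = r.pull.comp twistSwap ∧ IsReduction H' r'

/-- The twisted cocycle `F'` on the extension of `g` by `ω'` arises from the twisted cocycle
`F` on the extension of `g` by `ω` through reduction along `ω`, the isomorphism of cyclifications,
and oxidation along `ω'`. -/
def CocyclesTDual {g : Presentation} {ω ω' : g.CE} {hω : ω ∈ g.homog (2 * 2, 0)}
    {hω' : ω' ∈ g.homog (2 * 2, 0)} {H : (g.ext 2 ω hω).CE} {H' : (g.ext 2 ω' hω').CE} {m : ℤ}
    (F : TwistedCocycle (g.ext 2 ω hω) H m)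
    (F' : TwistedCocycle (g.ext 2 ω' hω') H' (m - 3)) : Prop :=
  ∃ (r : Hom g ((twistAlg 3 m).cyc 2)) (r' : Hom g ((twistAlg 3 (m - 3)).cyc 2)),
    IsReduction F.1 r ∧ r'.pull = r.pull.comp (cocycleSwap m) ∧ IsReduction F'.1 r'

/-! ## 11-dimensional super-Minkowski spacetime -/

/-- Index set of a basis of the real spinor representation `32 = (ℝ²)^{⊗5}`. -/
abbrev SpinorIdx : Type := Fin 2 × Fin 2 × Fin 2 × Fin 2 × Fin 2

/-- Real `2 × 2` matrices. -/
abbrev M₂ : Type := Matrix (Fin 2) (Fin 2) ℝ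

/-- The first Pauli matrix. -/
def sX : M₂ := !![0, 1; 1, 0]

/-- The third Pauli matrix. -/
def sZ : M₂ := !![1, 0; 0, -1]

/-- `i` times the second Pauli matrix. -/
def sE : M₂ := !![0, 1; -1, 0]

/-- The five-fold Kronecker product. -/
def kron5 (A B C D E : M₂) : Matrix SpinorIdx SpinorIdx ℝ := A ⊗ₖ (B ⊗ₖ (C ⊗ₖ (D ⊗ₖ E)))

/-- The Clifford generators `Γ_a`, `a = 0, …, 10`, of the Majorana representation `32`. -/
def Gam : Fin 11 → Matrix SpinorIdx SpinorIdx ℝ :=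
  ![kron5 1 1 1 1 sE,
    kron5 sE sE sE sE sX,
    kron5 1 sX sE sE sX,
    kron5 1 sZ sE sE sX,
    kron5 sX sE 1 sE sX,
    kron5 sZ sE 1 sE sX,
    kron5 sE 1 sX sE sX,
    kron5 sE 1 sZ sE sX,
    kron5 1 1 1 sX sX,
    kron5 1 1 1 sZ sX,
    kron5 1 1 1 1 sZ]

/-- The diagonal entries of the Minkowski metric `η = diag(-1, 1, …, 1)`. -/
def mink (a : Fin 11) : ℝ := if a = 0 then -1 else 1

/-- The spinor metric `η_{αβ}`, the matrix of the spinor pairing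
`(ψ̄ φ) = ψ^α η_{αβ} φ^β`. -/
def spinorMetric : Matrix SpinorIdx SpinorIdx ℝ := Gam 0

theorem kron5_mul (A B C D E A' B' C' D' E' : M₂) :
    kron5 A B C D E * kron5 A' B' C' D' E' =
      kron5 (A * A') (B * B') (C * C') (D * D') (E * E') := by
  simp only [kron5, ← Matrix.mul_kronecker_mul]

theorem kron5_neg (A B C D E : M₂) :
    kron5 (-A) B C D E = - kron5 A B C D E ∧ kron5 A (-B) C D E = - kron5 A B C D E ∧
    kron5 A B (-C) D E = - kron5 A B C D E ∧ kron5 A B C (-D) E = - kron5 A B C D E ∧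
    kron5 A B C D (-E) = - kron5 A B C D E := by
  refine ⟨?_, ?_, ?_, ?_, ?_⟩ <;> ext i j <;> simp [kron5]

theorem kron5_one : kron5 1 1 1 1 1 = 1 := by
  simp only [kron5, Matrix.one_kronecker_one]

theorem kron5_transpose (A B C D E : M₂) :
    (kron5 A B C D E).transpose
      = kron5 A.transpose B.transpose C.transpose D.transpose E.transpose := by
  ext i j; simp [kron5]

theorem pauli :
    sX * sX = 1 ∧ sZ * sZ = 1 ∧ sE * sE = -1 ∧ sX * sZ = -sE ∧ sZ * sX = sE ∧
    sX * sE = -sZ ∧ sE * sX = sZ ∧ sZ * sE = sX ∧ sE * sZ = -sX := by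
  refine ⟨?_, ?_, ?_, ?_, ?_, ?_, ?_, ?_, ?_⟩ <;> ext i j <;> fin_cases i <;> fin_cases j <;>
    simp [sX, sZ, sE]

theorem pauli_transpose :
    sX.transpose = sX ∧ sZ.transpose = sZ ∧ sE.transpose = -sE := by
  refine ⟨?_, ?_, ?_⟩ <;> ext i j <;> fin_cases i <;> fin_cases j <;> simp [sX, sZ, sE]

/-- The Clifford relation `Γ_a Γ_b + Γ_b Γ_a = 2 η_{ab}`. -/
theorem Gam_clifford (a b : Fin 11) :
    Gam a * Gam b + Gam b * Gam a = if a = b then (2 * mink a) • 1 else 0 := by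
  obtain ⟨h1, h2, h3, h4, h5, h6, h7, h8, h9⟩ := pauli
  fin_cases a <;> fin_cases b <;>
    simp [Gam, mink, kron5_mul, h1, h2, h3, h4, h5, h6, h7, h8, h9, kron5_neg, kron5_one] <;>
    module

/-- The volume element `Γ_0 Γ_1 ⋯ Γ_10` is the identity. -/
theorem Gam_volume : (List.ofFn Gam).prod = 1 := by
  obtain ⟨h1, h2, h3, h4, h5, h6, h7, h8, h9⟩ := pauli
  simp [Gam, kron5_mul, h3, h4, h6, kron5_neg, kron5_one]

/-- The spinor pairing is skew-symmetric. -/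
theorem spinorMetric_skew : spinorMetric.transpose = - spinorMetric := by
  simp [spinorMetric, Gam, kron5_transpose, pauli_transpose, kron5_neg]

/-- The spinor pairing is non-degenerate. -/
theorem spinorMetric_isUnit : IsUnit spinorMetric := by
  have h : spinorMetric * (- spinorMetric) = 1 := by
    obtain ⟨h1, h2, h3, h4, h5, h6, h7, h8, h9⟩ := pauli
    simp [spinorMetric, Gam, kron5_mul, kron5_neg, kron5_one, h3]
  exact IsUnit.of_mul_eq_one _ h

/-- The Clifford generators are skew self-adjoint for the spinor pairing. -/
theorem Gam_skewAdjoint (a : Fin 11) :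
    (Gam a).transpose * spinorMetric = - (spinorMetric * Gam a) := by
  obtain ⟨h1, h2, h3, h4, h5, h6, h7, h8, h9⟩ := pauli
  fin_cases a <;>
    simp [Gam, spinorMetric, kron5_transpose, pauli_transpose, kron5_mul, h3, h6, h7, h8, h9,
      kron5_neg, kron5_one]

/-- The skew-symmetrized products
`Γ_{a_1 ⋯ a_k} = (1/k!) ∑_σ sgn(σ) Γ_{a_σ(1)} ⋯ Γ_{a_σ(k)}`. -/
def GamSkew {k : ℕ} (a : Fin k → Fin 11) : Matrix SpinorIdx SpinorIdx ℝ :=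
  (k.factorial : ℝ)⁻¹ • ∑ σ : Equiv.Perm (Fin k),
    ((Equiv.Perm.sign σ : ℤ) : ℝ) • (List.ofFn fun i => Gam (a (σ i))).prod

/-- Generators of `CE(ℝ^{1,10|32})`: `ψ^α` and `e^a`. -/
inductive MinkGen : Type
  | psi : SpinorIdx → MinkGen
  | e : Fin 11 → MinkGen

/-- `deg ψ^α = (1, odd)` and `deg e^a = (1, evn)`. -/
def minkDeg : MinkGen → BiDeg
  | .psi _ => (1, 1)
  | .e _ => (1, 0)

/-- The generator `ψ^α`. -/
def psi (α : SpinorIdx) : GCA minkDeg := GCA.gen minkDeg (.psi α)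

/-- The generator `e^a`. -/
def vielb (a : Fin 11) : GCA minkDeg := GCA.gen minkDeg (.e a)

/-- The spinor bilinear `(ψ̄ M ψ) = ψ^α η_{αβ} M^β_γ ψ^γ`. -/
def bilin (M : Matrix SpinorIdx SpinorIdx ℝ) : GCA minkDeg :=
  ∑ α, ∑ γ, (spinorMetric * M) α γ • (psi α * psi γ)

theorem bilin_mem (M : Matrix SpinorIdx SpinorIdx ℝ) : bilin M ∈ GCA.homog minkDeg (2, 0) := by
  refine Submodule.sum_mem _ fun α _ => Submodule.sum_mem _ fun γ _ =>
    Submodule.smul_mem _ _ ?_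
  have h := mul_homog (gen_mem (deg := minkDeg) (.psi α)) (gen_mem (deg := minkDeg) (.psi γ))
  have e : minkDeg (.psi α) + minkDeg (.psi γ) = (2, 0) := by
    simp only [minkDeg]; decide
  rw [e] at h
  exact h

theorem vielb_mem (a : Fin 11) : vielb a ∈ GCA.homog minkDeg (1, 0) :=
  gen_mem (deg := minkDeg) (.e a)

/-- `d ψ^α = 0` and `d e^a = (ψ̄ Γ^a ψ)`, where `Γ^a = η^{ab} Γ_b`. -/
def minkDiff : MinkGen → GCA minkDeg
  | .psi _ => 0
  | .e a => bilin (mink a • Gam a)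

theorem minkDiff_mem : ∀ i, minkDiff i ∈ GCA.homog minkDeg (minkDeg i + (1, 0)) := by
  rintro (α | a)
  · rw [minkDiff]
    exact Submodule.zero_mem _
  · have e : minkDeg (.e a) + (1, 0) = (2, 0) := by simp only [minkDeg]; decide
    rw [minkDiff, e]
    exact bilin_mem _

/-- The 11-dimensional super-Minkowski algebra `ℝ^{1,10|32}`. -/
abbrev superMink : Presentation where
  Gen := MinkGen
  deg := minkDeg
  diff := minkDiff
  diff_mem := minkDiff_mem

/-- `G₄ = (1/2) (ψ̄ Γ_{a₁a₂} ψ) e^{a₁} e^{a₂}`. -/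
def G4 : superMink.CE :=
  (1 / 2 : ℝ) • ∑ a : Fin 2 → Fin 11,
    bilin (GamSkew a) * (List.ofFn fun i => vielb (a i)).prod

/-- `G₇ = (1/5!) (ψ̄ Γ_{a₁⋯a₅} ψ) e^{a₁} ⋯ e^{a₅}`. -/
def G7 : superMink.CE :=
  (1 / (Nat.factorial 5) : ℝ) • ∑ a : Fin 5 → Fin 11,
    bilin (GamSkew a) * (List.ofFn fun i => vielb (a i)).prod

theorem G4_mem : G4 ∈ superMink.homog (2 * 2, 0) := by
  refine Submodule.smul_mem _ _ (Submodule.sum_mem _ fun a _ => ?_)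
  have h := mul_homog (bilin_mem (GamSkew a))
    (mul_homog (vielb_mem (a 0)) (vielb_mem (a 1)))
  have e : ((2, 0) : BiDeg) + ((1, 0) + (1, 0)) = (2 * 2, 0) := by decide
  rw [e] at h
  simpa [List.ofFn_succ] using h

theorem neg_G4_mem : -G4 ∈ superMink.homog (2 * 2, 0) := neg_mem G4_mem

/-! ## The M2-brane extension and its reflected copy -/

/-- The extension `𝔪2𝔟𝔯𝔞𝔫𝔢` of `ℝ^{1,10|32}` by `G₄`: `d c₃ = G₄`. -/
abbrev m2brane : Presentation := superMink.ext 2 G4 G4_mem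

/-- The extension `𝔪2𝔟𝔯𝔞𝔫𝔢⁻` of `ℝ^{1,10|32}` by `-G₄`: `d c₃⁻ = -G₄`. -/
abbrev m2braneMinus : Presentation := superMink.ext 2 (-G4) neg_G4_mem

/-- The generator `c₃`. -/
abbrev c3 : m2brane.CE := superMink.extGen 2 G4 G4_mem

/-- The generator `c₃⁻`. -/
abbrev c3Minus : m2braneMinus.CE := superMink.extGen 2 (-G4) neg_G4_mem

/-- The inclusion `p^* : CE(ℝ^{1,10|32}) → CE(𝔪2𝔟𝔯𝔞𝔫𝔢)`. -/
abbrev pullP : superMink.CE →ₐ[ℝ] m2brane.CE := superMink.extIncl 2 G4 G4_mem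

/-- The inclusion `p_-^* : CE(ℝ^{1,10|32}) → CE(𝔪2𝔟𝔯𝔞𝔫𝔢⁻)`. -/
abbrev pullPMinus : superMink.CE →ₐ[ℝ] m2braneMinus.CE := superMink.extIncl 2 (-G4) neg_G4_mem

/-- The basic part of an element of `CE(𝔪2𝔟𝔯𝔞𝔫𝔢)`. -/
abbrev basP : m2brane.CE →ₐ[ℝ] superMink.CE := superMink.bas 2 G4 G4_mem

/-- The basic part of an element of `CE(𝔪2𝔟𝔯𝔞𝔫𝔢⁻)`. -/
abbrev basPMinus : m2braneMinus.CE →ₐ[ℝ] superMink.CE := superMink.bas 2 (-G4) neg_G4_mem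

/-- Fiber integration `p_*` on `CE(𝔪2𝔟𝔯𝔞𝔫𝔢)`. -/
abbrev fibP : m2brane.CE →ₗ[ℝ] superMink.CE := superMink.fib 2 G4 G4_mem

/-- Fiber integration `(p_-)_*` on `CE(𝔪2𝔟𝔯𝔞𝔫𝔢⁻)`. -/
abbrev fibPMinus : m2braneMinus.CE →ₗ[ℝ] superMink.CE := superMink.fib 2 (-G4) neg_G4_mem

/-- The Page charge `G̃₇ = 2 G₇ - c₃ G₄`. -/
def pageCharge : m2brane.CE := 2 * pullP G7 - c3 * pullP G4

/-- The reflected Page charge `G̃₇⁻ = 2 G₇ + c₃⁻ G₄`. -/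
def pageChargeMinus : m2braneMinus.CE := 2 * pullPMinus G7 + c3Minus * pullPMinus G4

end SuperLInfty

end

open SuperLInfty SuperLInfty.Presentation

/-!
An element of the extension of `𝔤` by a 4-cocycle `ω` is a pair `(α_bas, p_* α)`. For the twist
`K + c ω'`, where `d K = -ω ω'`, a family `(F_k)` is a twisted cocycle exactly when
`d (F_k)_bas = K (F_{k-1})_bas - ω p_* F_k` and `d p_* F_k = K p_* F_{k-1} - ω' (F_{k-1})_bas`.
Up to an index shift the two equations are exchanged by swapping `ω` with `ω'` and basic parts with
fibers: this is higher T-duality, and it is a bijection because swapping twice is the identity. As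
the degrees of a cocycle and of its dual never agree mod 6, the duality is non-trivial as soon as
some twisted cocycle is non-zero, for instance one with a component `d y ≠ 0`.

For `ω = G₄`, `ω' = -G₄`, `K = 2 G₇` one needs `d G₄ = 0` and `d G₇ = ½ G₄²`. Both follow from
`(ψ̄ Γ^a ψ) (ψ̄ Γ_{ab} ψ) = 0`: the first directly, the second from its variation along
`δψ = Γ_{cde} ψ`. Splitting `32 = 16 ⊗ 2` reduces this Fierz identity to
`∑ γ_i(x, x) γ_i(x, y) = |x|² ⟨x, y⟩` for the nine symmetric Clifford generators of Spin(9).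
-/

open scoped Kronecker

noncomputable section

namespace SuperLInfty

namespace GCA

variable {I J : Type} {deg : I → BiDeg} {deg' : J → BiDeg}

theorem algHom_ext {B : Type} [Ring B] [Algebra ℝ B] {φ χ : GCA deg →ₐ[ℝ] B}
    (h : ∀ i, φ (gen deg i) = χ (gen deg i)) : φ = χ := by
  ext x
  induction x using GCA.induction with
  | algebraMap r => simp only [AlgHom.commutes]
  | gen i => exact h i
  | mul x y hx hy => simp only [map_mul, hx, hy]
  | add x y hx hy => simp only [map_add, hx, hy]

theorem map_gen_eq_id : map (deg := deg) (gen deg) gen_mem = AlgHom.id ℝ (GCA deg) :=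
  algHom_ext fun i => by simp

theorem algHom_invol (φ : GCA deg →ₐ[ℝ] GCA deg')
    (h : ∀ i, φ (gen deg i) ∈ homog deg' (deg i)) (x : GCA deg) :
    φ (invol deg x) = invol deg' (φ x) := by
  have comm : φ.comp (invol deg) = (invol deg').comp φ := algHom_ext fun i => by
    simp [invol_of_mem (h i)]
  exact DFunLike.congr_fun comm x

/-- The algebra endomorphism scaling elements of bidegree `(n, σ)` by `2 ^ n`; it separates the
homogeneous subspaces of different degrees. -/
def scale (deg : I → BiDeg) : GCA deg →ₐ[ℝ] GCA deg :=
  map (fun i => (2 : ℝ) ^ (deg i).1 • gen deg i) fun i => Submodule.smul_mem _ _ (gen_mem i)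

theorem scale_of_mem {a : BiDeg} {x : GCA deg} (hx : x ∈ homog deg a) :
    scale deg x = (2 : ℝ) ^ a.1 • x := by
  induction hx using Submodule.span_induction with
  | mem x hx =>
    obtain ⟨l, rfl, rfl⟩ := hx
    induction l with
    | nil => simp
    | cons i l ih =>
      have scale_gen : scale deg (gen deg i) = (2 : ℝ) ^ (deg i).1 • gen deg i := map_gen _ _ i
      simp only [List.map_cons, List.prod_cons, List.sum_cons, map_mul, ih, scale_gen,
        Prod.fst_add, zpow_add₀ (two_ne_zero (α := ℝ)), smul_mul_assoc, mul_smul_comm, smul_smul]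
      rw [mul_comm]
  | zero => simp
  | add y z _ _ hy hz => rw [map_add, hy, hz, smul_add]
  | smul r y _ hy => rw [map_smul, hy, smul_comm]

theorem eq_zero_of_mem_of_mem {a b : BiDeg} (hab : a.1 ≠ b.1) {x : GCA deg}
    (ha : x ∈ homog deg a) (hb : x ∈ homog deg b) : x = 0 := by
  have h : (2 : ℝ) ^ a.1 • x = (2 : ℝ) ^ b.1 • x := (scale_of_mem ha).symm.trans (scale_of_mem hb)
  rw [← sub_eq_zero, ← sub_smul, smul_eq_zero, sub_eq_zero] at h
  exact h.resolve_left fun h2 => hab (zpow_right_injective₀ two_pos (by norm_num) h2)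

theorem koszul_even_left (b : BiDeg) {k : ℤ} (hk : Even k) : koszul (k, 0) b = 1 := by
  simp [koszul, Int.negOnePow_even _ (hk.mul_right _)]

theorem commute_of_mem_even {k : ℤ} (hk : Even k) {x : GCA deg} (hx : x ∈ homog deg (k, 0))
    (y : GCA deg) : Commute x y := by
  induction y using GCA.induction with
  | algebraMap r => exact (Algebra.commutes r x).symm
  | gen i => rw [Commute, SemiconjBy, homog_comm hx (gen_mem i), koszul_even_left _ hk, one_smul]
  | mul y z hy hz => exact hy.mul_right hz
  | add y z hy hz => exact hy.add_right hz

theorem parity_even {k : ℤ} (hk : Even k) (σ : ZMod 2) : parity (k, σ) = 1 := by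
  simp [parity, Int.negOnePow_even _ hk]

theorem parity_odd {k : ℤ} (hk : Odd k) (σ : ZMod 2) : parity (k, σ) = -1 := by
  simp [parity, Int.negOnePow_odd _ hk]

theorem parity_add_one (a : BiDeg) : parity (a + (1, 0)) = -parity a := by
  simp [parity, Int.negOnePow_succ]

theorem invol_of_mem_even {k : ℤ} (hk : Even k) {σ : ZMod 2} {x : GCA deg}
    (hx : x ∈ homog deg (k, σ)) : invol deg x = x := by
  rw [invol_of_mem hx, parity_even hk, one_smul]

theorem invol_of_mem_odd {k : ℤ} (hk : Odd k) {σ : ZMod 2} {x : GCA deg}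
    (hx : x ∈ homog deg (k, σ)) : invol deg x = -x := by
  rw [invol_of_mem hx, parity_odd hk, neg_one_smul]

theorem mul_self_of_mem_odd {k : ℤ} (hk : Odd k) {x : GCA deg} (hx : x ∈ homog deg (k, 0)) :
    x * x = 0 := by
  have h : x * x = -(x * x) := by
    conv_lhs => rw [homog_comm hx hx, koszul_odd _ hk, parity_odd hk, neg_one_smul]
  have two_smul_eq_zero : (2 : ℝ) • (x * x) = 0 := by
    rw [two_smul, ← eq_neg_iff_add_eq_zero, ← h]
  exact (smul_eq_zero.mp two_smul_eq_zero).resolve_left two_ne_zero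

theorem prod_ofFn_mem {n : ℕ} {a : BiDeg} {x : Fin n → GCA deg} (hx : ∀ i, x i ∈ homog deg a) :
    (List.ofFn x).prod ∈ homog deg (n • a) := by
  induction n with
  | zero => simpa using one_homog
  | succ n ih =>
    rw [List.ofFn_succ, List.prod_cons, succ_nsmul']
    exact mul_homog (hx 0) (ih fun i => hx i.succ)

/-- The product of `n` elements of bidegree `(k, evn)`, `k` odd, as an alternating map: the
universal property of the exterior algebra makes the product alternating. -/
def oddProd (deg : I → BiDeg) {k : ℤ} (hk : Odd k) (n : ℕ) :
    homog deg (k, 0) [⋀^Fin n]→ₗ[ℝ] GCA deg :=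
  (ExteriorAlgebra.lift ℝ ⟨(homog deg (k, 0)).subtype,
    fun x => mul_self_of_mem_odd hk x.2⟩).toLinearMap.compAlternatingMap
      (ExteriorAlgebra.ιMulti ℝ n)

theorem oddProd_apply {k : ℤ} (hk : Odd k) {n : ℕ} (x : Fin n → homog deg (k, 0)) :
    oddProd deg hk n x = (List.ofFn fun i => (x i : GCA deg)).prod := by
  rw [oddProd, LinearMap.compAlternatingMap_apply, ExteriorAlgebra.ιMulti_apply,
    AlgHom.toLinearMap_apply, map_list_prod, List.map_ofFn]
  congr 2
  ext i
  simp

variable {k : ℤ} {n : ℕ} {x : Fin n → GCA deg}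

theorem prod_ofFn_comp_perm (hk : Odd k) (hx : ∀ i, x i ∈ homog deg (k, 0))
    (σ : Equiv.Perm (Fin n)) :
    (List.ofFn (x ∘ σ)).prod = Equiv.Perm.sign σ • (List.ofFn x).prod := by
  have h := (oddProd deg hk n).map_perm (fun i => ⟨x i, hx i⟩) σ
  simpa only [oddProd_apply, Function.comp_def] using h

theorem prod_ofFn_eq_zero (hk : Odd k) (hx : ∀ i, x i ∈ homog deg (k, 0))
    (hinj : ¬ Function.Injective x) : (List.ofFn x).prod = 0 := by
  have h := (oddProd deg hk n).map_eq_zero_of_not_injective (fun i => ⟨x i, hx i⟩)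
    fun h => hinj fun i j hij => h (Subtype.ext hij)
  simpa only [oddProd_apply] using h

end GCA

open GCA

namespace Presentation

variable {g h : Presentation}

theorem d_gen (i : g.Gen) : g.d (g.gen i) = g.diff i := oddDer_gen _ _ _ _ _ _ i

theorem d_mul (x y : g.CE) : g.d (x * y) = g.d x * y + invol g.deg x * g.d y := by
  have leibniz := oddDer_mul (GCA.gen g.deg) gen_mem 1 odd_one g.diff g.diff_mem x y
  rwa [map_gen_eq_id] at leibniz

theorem d_one : g.d 1 = 0 := oddDer_one _ _ _ _ _ _

theorem d_algebraMap (r : ℝ) : g.d (algebraMap ℝ _ r) = 0 := by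
  rw [Algebra.algebraMap_eq_smul_one, map_smul, d_one, smul_zero]

theorem d_mem {a : BiDeg} {x : g.CE} (hx : x ∈ g.homog a) : g.d x ∈ g.homog (a + (1, 0)) :=
  oddDer_mem _ _ _ _ _ _ hx

theorem d_mul_even {k : ℤ} (hk : Even k) {σ : ZMod 2} {x : g.CE} (hx : x ∈ g.homog (k, σ))
    (y : g.CE) : g.d (x * y) = g.d x * y + x * g.d y := by
  rw [d_mul, invol_of_mem_even hk hx]

theorem d_mul_odd {k : ℤ} (hk : Odd k) {σ : ZMod 2} {x : g.CE} (hx : x ∈ g.homog (k, σ))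
    (y : g.CE) : g.d (x * y) = g.d x * y - x * g.d y := by
  rw [d_mul, invol_of_mem_odd hk hx, neg_mul, sub_eq_add_neg]

theorem d_mul_of_closed {k : ℤ} (hk : Even k) {σ : ZMod 2} {x : g.CE}
    (hx : x ∈ g.homog (k, σ)) (hdx : g.d x = 0) (y : g.CE) : g.d (x * y) = x * g.d y := by
  rw [d_mul_even hk hx, hdx, zero_mul, zero_add]

theorem d_prod_ofFn {k : ℤ} (hk : Odd k) {n : ℕ} (x : Fin (n + 1) → g.CE)
    (hx : ∀ i, x i ∈ g.homog (k, 0)) :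
    g.d (List.ofFn x).prod =
      ∑ i : Fin (n + 1), (-1 : ℝ) ^ (i : ℕ) • (g.d (x i) * (List.ofFn (x ∘ i.succAbove)).prod) := by
  have central (i) (y : g.CE) : Commute (g.d (x i)) y :=
    commute_of_mem_even hk.add_one (by simpa using d_mem (hx i)) y
  induction n with
  | zero => simp
  | succ n ih =>
    have tail (i : Fin (n + 1)) : (List.ofFn (x ∘ i.succ.succAbove)).prod =
        x 0 * (List.ofFn ((fun j => x j.succ) ∘ i.succAbove)).prod := by
      simp [List.ofFn_succ, Function.comp_def]
    rw [List.ofFn_succ, List.prod_cons, d_mul_odd hk (hx 0),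
      ih _ (fun i => hx i.succ) (fun i => central i.succ), Fin.sum_univ_succ (n := n + 1),
      Finset.mul_sum, sub_eq_add_neg, ← Finset.sum_neg_distrib]
    congr 1
    · simp [Function.comp_def]
    · refine Finset.sum_congr rfl fun i _ => ?_
      rw [tail, mul_smul_comm, ← (central i.succ (x 0)).left_comm, Fin.val_succ, pow_succ,
        mul_neg_one, neg_smul]

theorem d_invol (x : g.CE) : g.d (invol g.deg x) = -invol g.deg (g.d x) := by
  induction x using GCA.induction with
  | algebraMap r => simp [d_algebraMap]
  | gen i =>
    rw [invol_gen, map_smul, d_gen, invol_of_mem (g.diff_mem i), parity_add_one, neg_smul, neg_neg]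
  | mul x y hx hy => simp only [map_mul, d_mul, map_add, hx, hy, neg_mul, mul_neg, neg_add]
  | add x y hx hy => simp only [map_add, hx, hy, neg_add]

theorem isSuperLInfty_of_gen (hg : ∀ i, g.d (g.diff i) = 0) : g.IsSuperLInfty := by
  intro x
  induction x using GCA.induction with
  | algebraMap r => simp [d_algebraMap]
  | gen i => rw [d_gen, hg]
  | mul x y hx hy => simp [d_mul, map_add, d_invol, hx, hy]
  | add x y hx hy => simp only [map_add, hx, hy, add_zero]

theorem algHom_d (φ : h.CE →ₐ[ℝ] g.CE) (hφ : ∀ i, φ (h.gen i) ∈ g.homog (h.deg i))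
    (hd : ∀ i, φ (h.diff i) = g.d (φ (h.gen i))) (x : h.CE) : φ (h.d x) = g.d (φ x) := by
  induction x using GCA.induction with
  | algebraMap r => simp only [AlgHom.commutes, d_algebraMap, map_zero]
  | gen i => rw [d_gen]; exact hd i
  | mul x y hx hy => simp only [d_mul, map_add, map_mul, hx, hy, algHom_invol φ hφ]
  | add x y hx hy => simp only [map_add, hx, hy]

/-- The homomorphism determined by the images of the generators. -/
def Hom.ofGen (f : h.Gen → g.CE) (hf : ∀ i, f i ∈ g.homog (h.deg i))
    (hd : ∀ i, GCA.map f hf (h.diff i) = g.d (f i)) : Hom g h where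
  pull := GCA.map f hf
  pull_mem a x hx := GCA.map_mem f hf hx
  pull_d := algHom_d _ (fun i => by rw [map_gen]; exact hf i) fun i => by rw [map_gen, hd]

theorem Hom.ext_gen {f f' : Hom g h} (hgen : ∀ i, f.pull (h.gen i) = f'.pull (h.gen i)) :
    f = f' := by
  have hpull : f.pull = f'.pull := GCA.algHom_ext hgen
  cases f; cases f'; cases hpull; rfl

theorem Hom.pull_gen_mem (f : Hom g h) (i : h.Gen) : f.pull (h.gen i) ∈ g.homog (h.deg i) :=
  f.pull_mem _ _ (gen_mem i)

/-- Composition of homomorphisms, i.e. of pullbacks in the opposite order. -/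
def Hom.comp {k : Presentation} (f : Hom h k) (e : Hom g h) : Hom g k where
  pull := e.pull.comp f.pull
  pull_mem a x hx := e.pull_mem a _ (f.pull_mem a x hx)
  pull_d x := by simp [f.pull_d, e.pull_d]

section Ext

variable (t : ℤ) (ω : g.CE) (hω : ω ∈ g.homog (2 * t, 0))

theorem basicPart_gen_some (i : g.Gen) :
    basicPart g t (GCA.gen (extDeg g t) (some i)) = g.gen i :=
  map_gen (basVal g) (basVal_mem g t) (some i)

theorem basicPart_gen_none : basicPart g t (GCA.gen (extDeg g t) none) = 0 :=
  map_gen (basVal g) (basVal_mem g t) none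

theorem fiberInt_gen_some (i : g.Gen) : fiberInt g t (GCA.gen (extDeg g t) (some i)) = 0 :=
  oddDer_gen (basVal g) (basVal_mem g t) _ (odd_aux t) (fibVal g) (fibVal_mem g t) (some i)

theorem fiberInt_gen_none : fiberInt g t (GCA.gen (extDeg g t) none) = 1 :=
  oddDer_gen (basVal g) (basVal_mem g t) _ (odd_aux t) (fibVal g) (fibVal_mem g t) none

theorem fiberInt_algebraMap (r : ℝ) : fiberInt g t (algebraMap ℝ _ r) = 0 := by
  rw [Algebra.algebraMap_eq_smul_one, map_smul, fiberInt, oddDer_one, smul_zero]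

theorem basicPart_basicIncl (x : g.CE) : basicPart g t (basicIncl g t x) = x := by
  have left_inv : (basicPart g t).comp (basicIncl g t) = AlgHom.id ℝ _ :=
    GCA.algHom_ext fun i => by
      rw [AlgHom.comp_apply, basicIncl_gen, basicPart_gen_some, AlgHom.id_apply]
  exact DFunLike.congr_fun left_inv x

theorem fiberInt_basicIncl (x : g.CE) : fiberInt g t (basicIncl g t x) = 0 := by
  induction x using GCA.induction with
  | algebraMap r => rw [AlgHom.commutes, fiberInt_algebraMap]
  | gen i => rw [basicIncl_gen, fiberInt_gen_some]
  | mul x y hx hy => simp [fiberInt_mul, hx, hy]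
  | add x y hx hy => simp only [map_add, hx, hy, add_zero]

theorem basicPart_incl_add (x y : g.CE) :
    basicPart g t (basicIncl g t x + GCA.gen (extDeg g t) none * basicIncl g t y) = x := by
  rw [map_add, map_mul, basicPart_gen_none, zero_mul, basicPart_basicIncl, add_zero]

theorem fiberInt_incl_add (x y : g.CE) :
    fiberInt g t (basicIncl g t x + GCA.gen (extDeg g t) none * basicIncl g t y) = y := by
  rw [map_add, fiberInt_mul, fiberInt_basicIncl, fiberInt_basicIncl, basicPart_basicIncl,
    fiberInt_gen_none, one_mul, mul_zero, add_zero, zero_add]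

variable {t} in
theorem eq_of_basicPart_of_fiberInt {x y : GCA (extDeg g t)}
    (hbas : basicPart g t x = basicPart g t y) (hfib : fiberInt g t x = fiberInt g t y) :
    x = y := by
  rw [basic_add_fiber g t x, basic_add_fiber g t y, hbas, hfib]

theorem basicPart_mem {a : BiDeg} {x : GCA (extDeg g t)} (hx : x ∈ GCA.homog (extDeg g t) a) :
    basicPart g t x ∈ g.homog a := GCA.map_mem _ _ hx

theorem fiberInt_mem {a : BiDeg} {x : GCA (extDeg g t)} (hx : x ∈ GCA.homog (extDeg g t) a) :
    fiberInt g t x ∈ g.homog (a + (-(2 * t - 1), 0)) := oddDer_mem _ _ _ _ _ _ hx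

theorem gen_none_mem : GCA.gen (extDeg g t) none ∈ GCA.homog (extDeg g t) (2 * t - 1, 0) :=
  gen_mem (deg := extDeg g t) none

theorem incl_add_mem {a b : BiDeg} (hab : (2 * t - 1, 0) + b = a) {x y : g.CE}
    (hx : x ∈ g.homog a) (hy : y ∈ g.homog b) :
    basicIncl g t x + GCA.gen (extDeg g t) none * basicIncl g t y ∈ GCA.homog (extDeg g t) a :=
  add_mem (basicIncl_mem g t hx) (hab ▸ mul_homog (gen_none_mem t) (basicIncl_mem g t hy))

theorem d_basicIncl (x : g.CE) : (g.ext t ω hω).d (basicIncl g t x) = basicIncl g t (g.d x) :=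
  (algHom_d (g := g.ext t ω hω) (basicIncl g t)
    (fun i => basicIncl_mem g t (gen_mem i))
    (fun i => by rw [basicIncl_gen]; exact (d_gen (g := g.ext t ω hω) (some i)).symm) x).symm

theorem d_gen_none : (g.ext t ω hω).d (GCA.gen (extDeg g t) none) = basicIncl g t ω :=
  d_gen (g := g.ext t ω hω) none

theorem d_incl_add (x y : g.CE) :
    (g.ext t ω hω).d (basicIncl g t x + GCA.gen (extDeg g t) none * basicIncl g t y) =
      basicIncl g t (g.d x + ω * y) + GCA.gen (extDeg g t) none * basicIncl g t (-g.d y) := by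
  rw [map_add, d_basicIncl, d_mul_odd (g := g.ext t ω hω) ⟨t - 1, by ring⟩ (gen_none_mem t),
    d_basicIncl, d_gen_none]
  simp only [map_add, map_mul, map_neg, mul_neg]
  abel

theorem basicPart_d (x : GCA (extDeg g t)) :
    basicPart g t ((g.ext t ω hω).d x) = g.d (basicPart g t x) + ω * fiberInt g t x := by
  conv_lhs => rw [basic_add_fiber g t x, d_incl_add]
  exact basicPart_incl_add _ _ _

theorem fiberInt_d (x : GCA (extDeg g t)) :
    fiberInt g t ((g.ext t ω hω).d x) = -g.d (fiberInt g t x) := by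
  conv_lhs => rw [basic_add_fiber g t x, d_incl_add]
  exact fiberInt_incl_add _ _ _

theorem isSuperLInfty_ext (hg : g.IsSuperLInfty) (hdω : g.d ω = 0) :
    (g.ext t ω hω).IsSuperLInfty := by
  refine isSuperLInfty_of_gen ?_
  rintro (_ | i)
  · change (g.ext t ω hω).d (basicIncl g t ω) = 0
    rw [d_basicIncl, hdω, map_zero]
  · change (g.ext t ω hω).d (basicIncl g t (g.diff i)) = 0
    rw [d_basicIncl, ← d_gen, hg, map_zero]

end Ext

section Reduction

variable {t : ℤ} {ω : g.CE} {hω : ω ∈ g.homog (2 * t, 0)} (f : Hom (g.ext t ω hω) h)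

theorem cycIncl_gen (i : h.Gen) : cycIncl h t (h.gen i) = GCA.gen (cycDeg h t) (.base i) :=
  map_gen (deg := h.deg) _ _ i

theorem cycShift_gen (i : h.Gen) : cycShift h t (h.gen i) = GCA.gen (cycDeg h t) (.shift i) :=
  oddDer_gen (deg := h.deg) _ _ _ _ _ _ i

theorem cycShift_algebraMap (r : ℝ) : cycShift h t (algebraMap ℝ _ r) = 0 := by
  rw [Algebra.algebraMap_eq_smul_one, map_smul]
  exact (congrArg (r • ·) (oddDer_one _ _ _ _ _ _)).trans (smul_zero r)

theorem cycShift_mul (x y : h.CE) :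
    cycShift h t (x * y) =
      cycShift h t x * cycIncl h t y + cycIncl h t (invol h.deg x) * cycShift h t y :=
  oddDer_mul _ _ _ _ _ _ x y

/-- The values of the reduction of `f` on the generators of the cyclification. -/
def reductionVal : CycGen h.Gen → g.CE
  | .omega => ω
  | .base i => basicPart g t (f.pull (h.gen i))
  | .shift i => -fiberInt g t (f.pull (h.gen i))

theorem reductionVal_mem : ∀ i, reductionVal f i ∈ g.homog (cycDeg h t i)
  | .omega => hω
  | .base i => basicPart_mem t (f.pull_gen_mem i)
  | .shift i => neg_mem (fiberInt_mem t (f.pull_gen_mem i))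

theorem map_reductionVal_cycIncl (x : h.CE) :
    GCA.map (reductionVal f) (reductionVal_mem f) (cycIncl h t x) = basicPart g t (f.pull x) := by
  have comm : (GCA.map (reductionVal f) (reductionVal_mem f)).comp (cycIncl h t)
      = (basicPart g t).comp f.pull := GCA.algHom_ext fun i => by
    rw [AlgHom.comp_apply, cycIncl_gen, map_gen, AlgHom.comp_apply, reductionVal]
  exact DFunLike.congr_fun comm x

theorem map_reductionVal_cycShift (x : h.CE) :
    GCA.map (reductionVal f) (reductionVal_mem f) (cycShift h t x) =
      -fiberInt g t (f.pull x) := by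
  induction x using GCA.induction with
  | algebraMap r =>
    rw [AlgHom.commutes, cycShift_algebraMap, map_zero]
    exact (neg_eq_zero.mpr (fiberInt_algebraMap t r)).symm
  | gen i => rw [cycShift_gen, map_gen, reductionVal]
  | mul x y hx hy =>
    rw [cycShift_mul, map_mul, fiberInt_mul, map_add, map_mul, map_mul, hx, hy,
      map_reductionVal_cycIncl, map_reductionVal_cycIncl, algHom_invol f.pull f.pull_gen_mem]
    noncomm_ring
  | add x y hx hy => simp only [map_add, hx, hy, neg_add]

/-- The reduction `rdc_ω(f)` of a homomorphism `f` out of the extension by a closed `ω`. -/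
def reduction (hdω : g.d ω = 0) : Hom g (h.cyc t) :=
  Hom.ofGen (h := h.cyc t) (reductionVal f) (reductionVal_mem f) fun
    | .omega => (map_zero _).trans hdω.symm
    | .base i => by
      have bas_pull_d := congrArg (basicPart g t) (f.pull_d (h.gen i))
      rw [basicPart_d, d_gen] at bas_pull_d
      simp [cycDiff, map_reductionVal_cycIncl, reductionVal, bas_pull_d]
    | .shift i => by
      have fib_pull_d := congrArg (fiberInt g t) (f.pull_d (h.gen i))
      rw [fiberInt_d, d_gen] at fib_pull_d
      simp [cycDiff, map_reductionVal_cycShift, reductionVal, fib_pull_d]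

theorem isReduction_reduction (hdω : g.d ω = 0) : IsReduction f (reduction f hdω) :=
  ⟨map_gen _ (reductionVal_mem f) _, fun _ => map_gen _ (reductionVal_mem f) _,
    fun _ => map_gen _ (reductionVal_mem f) _⟩

theorem IsReduction.pull_cycBase {r : Hom g (h.cyc t)} (hr : IsReduction f r) {i : h.Gen}
    {x y : g.CE}
    (hi : f.pull (h.gen i) = basicIncl g t x + GCA.gen (extDeg g t) none * basicIncl g t y) :
    r.pull (cycBase h t i) = x :=
  (hr.2.1 i).trans ((congrArg (basicPart g t) hi).trans (basicPart_incl_add t x y))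

theorem IsReduction.pull_cycShiftGen {r : Hom g (h.cyc t)} (hr : IsReduction f r) {i : h.Gen}
    {x y : g.CE}
    (hi : f.pull (h.gen i) = basicIncl g t x + GCA.gen (extDeg g t) none * basicIncl g t y) :
    r.pull (cycShiftGen h t i) = -y :=
  (hr.2.2 i).trans (congrArg Neg.neg
    ((congrArg (fiberInt g t) hi).trans (fiberInt_incl_add t x y)))

end Reduction

section Reflection

variable (t : ℤ)

/-- The values on generators of the reflection `b ↦ -b`. -/
def reflectionVal (g : Presentation) : Option g.Gen → GCA (extDeg g t)
  | none => -GCA.gen (extDeg g t) none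
  | some i => GCA.gen (extDeg g t) (some i)

theorem reflectionVal_mem :
    ∀ i, reflectionVal t g i ∈ GCA.homog (extDeg g t) (extDeg g t i)
  | none => neg_mem (gen_none_mem t)
  | some i => gen_mem (deg := extDeg g t) (some i)

/-- The algebra endomorphism `b ↦ -b` of the extension, fixing the basic elements. -/
def reflect (g : Presentation) : GCA (extDeg g t) →ₐ[ℝ] GCA (extDeg g t) :=
  GCA.map (reflectionVal t g) (reflectionVal_mem t)

theorem reflect_gen_none :
    reflect t g (GCA.gen (extDeg g t) none) = -GCA.gen (extDeg g t) none := map_gen _ _ none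

theorem reflect_basicIncl (x : g.CE) : reflect t g (basicIncl g t x) = basicIncl g t x := by
  have comm : (reflect t g).comp (basicIncl g t) = basicIncl g t := GCA.algHom_ext fun i => by
    rw [AlgHom.comp_apply, basicIncl_gen, reflect, map_gen, reflectionVal]
  exact DFunLike.congr_fun comm x

theorem reflect_comp_self : (reflect t g).comp (reflect t g) = AlgHom.id ℝ _ :=
  GCA.algHom_ext fun
    | none => by
      rw [AlgHom.comp_apply, reflect_gen_none, map_neg, reflect_gen_none, neg_neg, AlgHom.id_apply]
    | some i => by
      rw [AlgHom.comp_apply, ← basicIncl_gen, reflect_basicIncl, reflect_basicIncl, AlgHom.id_apply]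

variable {t}

/-- The reflection `b ↦ -b` between the extensions by `ω` and `ω' = -ω`. -/
def reflection {ω ω' : g.CE} (hω : ω ∈ g.homog (2 * t, 0)) (hω' : ω' ∈ g.homog (2 * t, 0))
    (h : ω' = -ω) : Hom (g.ext t ω hω) (g.ext t ω' hω') :=
  Hom.ofGen (h := g.ext t ω' hω') (reflectionVal t g) (reflectionVal_mem t) fun
    | none => by
      change reflect t g (basicIncl g t ω') = (g.ext t ω hω).d (-GCA.gen (extDeg g t) none)
      rw [reflect_basicIncl, map_neg, d_gen_none, h, map_neg]
    | some i => (reflect_basicIncl t (g.diff i)).trans (d_gen (g := g.ext t ω hω) (some i)).symm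

end Reflection

end Presentation

section Duality

open Presentation

namespace TwistedCocycle

variable {g : Presentation} {H : g.CE} {m : ℤ}

theorem comp_mem (F : TwistedCocycle g H m) (k : ℤ) : F.comp k ∈ g.homog (2 * 3 * k + m, 0) :=
  F.1.pull_gen_mem (h := twistAlg 3 m) (some k)

theorem d_comp (F : TwistedCocycle g H m) (k : ℤ) : g.d (F.comp k) = H * F.comp (k - 1) := by
  have pull_d := F.1.pull_d (twistF 3 m k)
  rw [d_gen (g := twistAlg 3 m)] at pull_d
  refine pull_d.symm.trans ((map_mul F.1.pull (twistH 3 m) (twistF 3 m (k - 1))).trans ?_)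
  rw [F.2, comp]

theorem ext {F F' : TwistedCocycle g H m} (h : ∀ k, F.comp k = F'.comp k) : F = F' :=
  Subtype.ext (Hom.ext_gen fun
    | none => F.2.trans F'.2.symm
    | some k => h k)

theorem elim_mem (hH : H ∈ g.homog (2 * 3 + 1, 0)) {F : ℤ → g.CE}
    (hF : ∀ k, F k ∈ g.homog (2 * 3 * k + m, 0)) :
    ∀ i : Option ℤ, i.elim H F ∈ g.homog (twistDeg 3 m i)
  | none => hH
  | some k => hF k

/-- The twisted cocycle with given components. -/
def ofFamily (hH : H ∈ g.homog (2 * 3 + 1, 0)) (hdH : g.d H = 0) (F : ℤ → g.CE)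
    (hF : ∀ k, F k ∈ g.homog (2 * 3 * k + m, 0)) (hd : ∀ k, g.d (F k) = H * F (k - 1)) :
    TwistedCocycle g H m :=
  ⟨Hom.ofGen (h := twistAlg 3 m) (fun i => i.elim H F) (elim_mem hH hF) fun
    | none => (map_zero _).trans hdH.symm
    | some k => by
      change GCA.map _ _ (twistH 3 m * twistF 3 m (k - 1)) = g.d (F k)
      rw [map_mul, map_gen, map_gen, hd, Option.elim_none, Option.elim_some],
    map_gen _ (elim_mem hH hF) none⟩

theorem ofFamily_comp (hH : H ∈ g.homog (2 * 3 + 1, 0)) (hdH : g.d H = 0) (F : ℤ → g.CE)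
    (hF : ∀ k, F k ∈ g.homog (2 * 3 * k + m, 0)) (hd : ∀ k, g.d (F k) = H * F (k - 1)) (k : ℤ) :
    (ofFamily hH hdH F hF hd).comp k = F k :=
  map_gen _ (elim_mem hH hF) (some k)

section Pullback

variable {h : Presentation} {H' : h.CE}

/-- The pullback of a twisted cocycle along a homomorphism. -/
def pullback (f : Hom g h) (hf : f.pull H' = H) (F : TwistedCocycle h H' m) :
    TwistedCocycle g H m :=
  ⟨F.1.comp f, (congrArg f.pull F.2).trans hf⟩

/-- Pullback along an isomorphism. -/
def pullbackEquiv (f : Hom g h) (f' : Hom h g) (hf : f.pull H' = H)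
    (hff' : f.pull.comp f'.pull = AlgHom.id ℝ g.CE)
    (hf'f : f'.pull.comp f.pull = AlgHom.id ℝ h.CE) (m : ℤ) :
    TwistedCocycle h H' m ≃ TwistedCocycle g H m where
  toFun := pullback f hf
  invFun := pullback f' (by rw [← hf]; exact DFunLike.congr_fun hf'f H')
  left_inv F := ext fun k => DFunLike.congr_fun hf'f (F.comp k)
  right_inv F := ext fun k => DFunLike.congr_fun hff' (F.comp k)

end Pullback

/-- Twisted coboundaries: the components `d y` and `-H y` are those of `d_H y`. -/
theorem exists_comp_eq_d (hg : g.IsSuperLInfty) (hH : H ∈ g.homog (2 * 3 + 1, 0))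
    (hdH : g.d H = 0) {n k : ℤ} (hn : n + 1 = 2 * 3 * k + m) {y : g.CE}
    (hy : y ∈ g.homog (n, 0)) : ∃ F : TwistedCocycle g H m, F.comp k = g.d y := by
  have odd_seven : Odd (2 * 3 + 1 : ℤ) := ⟨3, rfl⟩
  refine ⟨ofFamily hH hdH (fun j => if j = k then g.d y else if j = k + 1 then -(H * y) else 0)
    (fun j => ?_) (fun j => ?_), by simp [ofFamily_comp]⟩
  · split_ifs with hj hj'
    · have hdy := d_mem hy
      rw [Prod.mk_add_mk, add_zero] at hdy
      rwa [hj, ← hn]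
    · have hHy := mul_homog hH hy
      rw [Prod.mk_add_mk, add_zero] at hHy
      rw [hj', show 2 * 3 * (k + 1) + m = 2 * 3 + 1 + n by linarith]
      exact neg_mem hHy
    · exact zero_mem _
  · rcases eq_or_ne j k with rfl | hk
    · simp [hg y, show j - 1 ≠ j + 1 by omega]
    rcases eq_or_ne j (k + 1) with rfl | hk1
    · simp [d_mul_odd odd_seven hH, hdH]
    rcases eq_or_ne j (k + 2) with rfl | hk2
    · simp [add_sub_assoc, ← mul_assoc, mul_self_of_mem_odd odd_seven hH]
    · simp [hk, hk1, show j - 1 ≠ k by omega, show j - 1 ≠ k + 1 by omega]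

theorem comp_ne_smul_comp {H' : g.CE} {n : ℤ} (hmn : ¬ 2 * 3 ∣ m - n) {F : TwistedCocycle g H m}
    {F' : TwistedCocycle g H' n} {k : ℤ} (hk : F.comp k ≠ 0) (j : ℤ) (c : ℝ) :
    F.comp k ≠ c • F'.comp j := fun hc => by
  refine hk (eq_zero_of_mem_of_mem ?_ (F.comp_mem k)
    (hc ▸ Submodule.smul_mem _ c (F'.comp_mem j)))
  simp only
  omega

end TwistedCocycle

/-! ### Higher T-duality -/

/-- Closed elements `ω`, `ω'` of degree 4 and `K` of degree 7 with `d K = - ω ω'`: the data defining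
a pair of T-dual extensions with twists `K + b ω'` and `K + b' ω`. -/
structure IsDualityDatum (g : Presentation) (ω ω' K : g.CE) : Prop where
  isSuperLInfty : g.IsSuperLInfty
  mem_left : ω ∈ g.homog (2 * 2, 0)
  mem_right : ω' ∈ g.homog (2 * 2, 0)
  mem_K : K ∈ g.homog (2 * 3 + 1, 0)
  d_left : g.d ω = 0
  d_right : g.d ω' = 0
  d_K : g.d K = -(ω * ω')

/-- The twist `K + b ω'` on the extension by `ω`. -/
def extTwist (g : Presentation) (K ω' : g.CE) : GCA (extDeg g 2) :=
  basicIncl g 2 K + GCA.gen (extDeg g 2) none * basicIncl g 2 ω'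

section ExtTwist

variable {g : Presentation} {K : g.CE} (ω' : g.CE)

theorem basicPart_extTwist_mul (x : GCA (extDeg g 2)) :
    basicPart g 2 (extTwist g K ω' * x) = K * basicPart g 2 x := by
  rw [map_mul, extTwist, basicPart_incl_add]

theorem fiberInt_extTwist_mul {k : ℤ} (hk : Odd k) {σ : ZMod 2} (hK : K ∈ g.homog (k, σ))
    (x : GCA (extDeg g 2)) :
    fiberInt g 2 (extTwist g K ω' * x) = ω' * basicPart g 2 x - K * fiberInt g 2 x := by
  rw [fiberInt_mul, basicPart_invol, extTwist, fiberInt_incl_add, basicPart_incl_add,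
    invol_of_mem_odd hk hK, neg_mul, sub_eq_add_neg]

theorem reflect_extTwist : reflect 2 g (extTwist g K ω') = extTwist g K (-ω') := by
  rw [extTwist, map_add, map_mul, reflect_basicIncl, reflect_basicIncl, reflect_gen_none, extTwist,
    map_neg, mul_neg, neg_mul]

end ExtTwist

namespace IsDualityDatum

variable {g : Presentation} {ω ω' K : g.CE} (D : IsDualityDatum g ω ω' K)

include D in
theorem symm : IsDualityDatum g ω' ω K where
  isSuperLInfty := D.isSuperLInfty
  mem_left := D.mem_right
  mem_right := D.mem_left
  mem_K := D.mem_K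
  d_left := D.d_right
  d_right := D.d_left
  d_K := by rw [D.d_K, commute_of_mem_even (even_two_mul 2) D.mem_left]

theorem ext_isSuperLInfty : (g.ext 2 ω D.mem_left).IsSuperLInfty :=
  isSuperLInfty_ext 2 ω D.mem_left D.isSuperLInfty D.d_left

theorem extTwist_mem : extTwist g K ω' ∈ (g.ext 2 ω D.mem_left).homog (2 * 3 + 1, 0) :=
  incl_add_mem 2 (by norm_num) D.mem_K D.mem_right

theorem d_extTwist : (g.ext 2 ω D.mem_left).d (extTwist g K ω') = 0 := by
  refine (d_incl_add 2 ω D.mem_left K ω').trans ?_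
  rw [D.d_K, D.d_right, neg_add_cancel, neg_zero, map_zero, mul_zero, add_zero]

theorem exists_hom_extTwist : ∃ H : Hom (g.ext 2 ω D.mem_left) (lineAlg 6),
    H.pull (lineGen 6) = extTwist g K ω' :=
  ⟨Hom.ofGen (h := lineAlg 6) (fun _ => extTwist g K ω') (fun _ => D.extTwist_mem)
    (fun _ => (map_zero _).trans D.d_extTwist.symm), map_gen _ (fun _ => D.extTwist_mem) ()⟩

theorem twistsTDual {H : Hom (g.ext 2 ω D.mem_left) (lineAlg 6)}
    {H' : Hom (g.ext 2 ω' D.mem_right) (lineAlg 6)} (hH : H.pull (lineGen 6) = extTwist g K ω')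
    (hH' : H'.pull (lineGen 6) = extTwist g K ω) : TwistsTDual H H' := by
  have hr := isReduction_reduction H D.d_left
  have hr' := isReduction_reduction H' D.d_right
  refine ⟨_, _, hr, GCA.algHom_ext fun i => ?_, hr'⟩
  rw [AlgHom.comp_apply, twistSwap, map_gen]
  match i with
  | .omega => rw [map_neg, hr.pull_cycShiftGen _ hH, neg_neg]; exact hr'.1
  | .base () => rw [hr.pull_cycBase _ hH]; exact hr'.pull_cycBase _ hH'
  | .shift () => rw [map_neg, hr.1]; exact hr'.pull_cycShiftGen _ hH'

variable {m : ℤ} (F : TwistedCocycle (g.ext 2 ω D.mem_left) (extTwist g K ω') m)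

theorem d_basicPart_comp (k : ℤ) : g.d (basicPart g 2 (F.comp k)) =
    K * basicPart g 2 (F.comp (k - 1)) - ω * fiberInt g 2 (F.comp k) := by
  rw [eq_sub_iff_add_eq, ← basicPart_d 2 ω D.mem_left, F.d_comp, basicPart_extTwist_mul]

theorem d_fiberInt_comp (k : ℤ) : g.d (fiberInt g 2 (F.comp k)) =
    K * fiberInt g 2 (F.comp (k - 1)) - ω' * basicPart g 2 (F.comp (k - 1)) := by
  rw [← neg_inj, ← fiberInt_d 2 ω D.mem_left, F.d_comp, fiberInt_extTwist_mul ω' ⟨3, rfl⟩ D.mem_K,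
    neg_sub]

section Dual

variable (s : ℤ) {n : ℤ} (hn : n = m - 3 + 6 * s)

/-- The components of the T-dual cocycle, renumbered by `s`. -/
def dualFamily (k : ℤ) : (g.ext 2 ω' D.mem_right).CE :=
  basicIncl g 2 (-fiberInt g 2 (F.comp (k + s)))
    + GCA.gen (extDeg g 2) none * basicIncl g 2 (-basicPart g 2 (F.comp (k + s - 1)))

include hn in
theorem dualFamily_mem (k : ℤ) :
    D.dualFamily F s k ∈ (g.ext 2 ω' D.mem_right).homog (2 * 3 * k + n, 0) := by
  have deg_fib : ((2 * 3 * (k + s) + m, 0) + (-(2 * 2 - 1), 0) : BiDeg) = (2 * 3 * k + n, 0) := by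
    rw [hn, Prod.mk_add_mk, add_zero]; ring_nf
  have deg_bas : ((2 * 2 - 1, 0) + (2 * 3 * (k + s - 1) + m, 0) : BiDeg) = (2 * 3 * k + n, 0) := by
    rw [hn, Prod.mk_add_mk, add_zero]; ring_nf
  exact incl_add_mem 2 deg_bas (deg_fib ▸ neg_mem (fiberInt_mem 2 (F.comp_mem (k + s))))
    (neg_mem (basicPart_mem 2 (F.comp_mem (k + s - 1))))

theorem d_dualFamily (k : ℤ) : (g.ext 2 ω' D.mem_right).d (D.dualFamily F s k) =
    extTwist g K ω * D.dualFamily F s (k - 1) := by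
  refine eq_of_basicPart_of_fiberInt ?_ ?_
  · rw [basicPart_d, basicPart_extTwist_mul, dualFamily, dualFamily, basicPart_incl_add,
      fiberInt_incl_add, basicPart_incl_add, map_neg, D.d_fiberInt_comp, sub_add_eq_add_sub k 1 s]
    noncomm_ring
  · rw [fiberInt_d, fiberInt_extTwist_mul ω ⟨3, rfl⟩ D.mem_K, dualFamily, dualFamily,
      fiberInt_incl_add, basicPart_incl_add, fiberInt_incl_add, map_neg, D.d_basicPart_comp,
      sub_add_eq_add_sub k 1 s]
    noncomm_ring

/-- The T-dual cocycle, with the components renumbered by `s`: both directions of higher T-duality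
are instances, with `s = 0` and `s = 1`. -/
def dual : TwistedCocycle (g.ext 2 ω' D.mem_right) (extTwist g K ω) n :=
  TwistedCocycle.ofFamily D.symm.extTwist_mem D.symm.d_extTwist (D.dualFamily F s)
    (D.dualFamily_mem F s hn) (D.d_dualFamily F s)

theorem dual_comp (k : ℤ) : (D.dual F s hn).comp k = D.dualFamily F s k :=
  TwistedCocycle.ofFamily_comp _ _ _ _ _ k

theorem basicPart_dual_comp (k : ℤ) :
    basicPart g 2 ((D.dual F s hn).comp k) = -fiberInt g 2 (F.comp (k + s)) := by
  rw [dual_comp, dualFamily, basicPart_incl_add]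

theorem fiberInt_dual_comp (k : ℤ) :
    fiberInt g 2 ((D.dual F s hn).comp k) = -basicPart g 2 (F.comp (k + s - 1)) := by
  rw [dual_comp, dualFamily, fiberInt_incl_add]

theorem dual_dual_comp {s' : ℤ} (hs : s + s' = 1) {l : ℤ} (hl : l = n - 3 + 6 * s') (k : ℤ) :
    (D.symm.dual (D.dual F s hn) s' hl).comp k = F.comp k := by
  refine eq_of_basicPart_of_fiberInt ?_ ?_
  · rw [D.symm.basicPart_dual_comp, D.fiberInt_dual_comp, neg_neg, show k + s' + s - 1 = k by omega]
  · rw [D.symm.fiberInt_dual_comp, D.basicPart_dual_comp, neg_neg, show k + s' - 1 + s = k by omega]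

end Dual

/-- Higher T-duality as a bijection of twisted cocycles. -/
def dualEquiv (m : ℤ) : TwistedCocycle (g.ext 2 ω D.mem_left) (extTwist g K ω') m ≃
    TwistedCocycle (g.ext 2 ω' D.mem_right) (extTwist g K ω) (m - 3) where
  toFun F := D.dual F 0 (by ring)
  invFun F := D.symm.dual F 1 (by ring)
  left_inv F := TwistedCocycle.ext (D.dual_dual_comp F 0 _ (by norm_num) _)
  right_inv F := TwistedCocycle.ext (D.symm.dual_dual_comp F 1 _ (by norm_num) _)

theorem dualEquiv_comp (k : ℤ) : (D.dualEquiv m F).comp k = -basicIncl g 2 (fiberInt g 2 (F.comp k))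
    - GCA.gen (extDeg g 2) none * basicIncl g 2 (basicPart g 2 (F.comp (k - 1))) := by
  refine (D.dual_comp F 0 (by ring) k).trans ?_
  simp only [dualFamily, add_zero, map_neg, mul_neg, sub_eq_add_neg]

theorem dualEquiv_symm_comp
    (F' : TwistedCocycle (g.ext 2 ω' D.mem_right) (extTwist g K ω) (m - 3)) (k : ℤ) :
    ((D.dualEquiv m).symm F').comp k = -basicIncl g 2 (fiberInt g 2 (F'.comp (k + 1)))
      - GCA.gen (extDeg g 2) none * basicIncl g 2 (basicPart g 2 (F'.comp k)) := by
  refine (D.symm.dual_comp F' 1 (by ring) k).trans ?_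
  simp only [dualFamily, sub_eq_add_neg, add_neg_cancel_right, map_neg, mul_neg]

theorem cocyclesTDual : CocyclesTDual F (D.dualEquiv m F) := by
  have hr := isReduction_reduction F.1 D.d_left
  have hr' := isReduction_reduction (D.dualEquiv m F).1 D.d_right
  refine ⟨_, _, hr, GCA.algHom_ext fun i => ?_, hr'⟩
  rw [AlgHom.comp_apply, cocycleSwap, map_gen]
  match i with
  | .omega => rw [cocycleSwapVal, map_neg, hr.pull_cycShiftGen _ F.2, neg_neg]; exact hr'.1
  | .base none =>
    rw [cocycleSwapVal, hr.pull_cycBase _ F.2]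
    exact hr'.pull_cycBase _ (D.dualEquiv m F).2
  | .base (some k) =>
    rw [cocycleSwapVal, hr.2.2]
    exact (hr'.pull_cycBase _ (D.dual_comp F 0 (by ring) k)).trans (by rw [add_zero]; rfl)
  | .shift none =>
    rw [cocycleSwapVal, map_neg, hr.1]
    exact hr'.pull_cycShiftGen _ (D.dualEquiv m F).2
  | .shift (some k) =>
    rw [cocycleSwapVal, hr.2.1]
    exact (hr'.pull_cycShiftGen _ (D.dual_comp F 0 (by ring) k)).trans
      (by rw [neg_neg, add_zero]; rfl)

section SelfDuality

variable (h : ω' = -ω)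

theorem reflection_extTwist :
    (reflection D.mem_left D.mem_right h).pull (extTwist g K ω) = extTwist g K ω' :=
  (reflect_extTwist ω).trans (by rw [h])

/-- The self-duality obtained from higher T-duality by pullback along the reflection. -/
def selfDualEquiv (m : ℤ) : TwistedCocycle (g.ext 2 ω D.mem_left) (extTwist g K ω') m ≃
    TwistedCocycle (g.ext 2 ω D.mem_left) (extTwist g K ω') (m - 3) :=
  (D.dualEquiv m).trans (TwistedCocycle.pullbackEquiv (reflection D.mem_left D.mem_right h)
    (reflection D.mem_right D.mem_left (by rw [h, neg_neg])) (D.reflection_extTwist h)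
    (reflect_comp_self 2) (reflect_comp_self 2) (m - 3))

theorem selfDualEquiv_comp (k : ℤ) :
    (D.selfDualEquiv h m F).comp k = -basicIncl g 2 (fiberInt g 2 (F.comp k))
      + GCA.gen (extDeg g 2) none * basicIncl g 2 (basicPart g 2 (F.comp (k - 1))) := by
  refine (congrArg (reflect 2 g) (D.dualEquiv_comp F k)).trans ?_
  rw [map_sub, map_neg, map_mul, reflect_basicIncl, reflect_basicIncl, reflect_gen_none, neg_mul,
    sub_neg_eq_add]

theorem exists_selfDualEquiv_comp_ne_zero {k : ℤ} (hk : F.comp k ≠ 0) :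
    ∃ j, (D.selfDualEquiv h m F).comp j ≠ 0 := by
  by_contra! comp_eq_zero
  have components (j : ℤ) : fiberInt g 2 (F.comp j) = 0 ∧ basicPart g 2 (F.comp (j - 1)) = 0 := by
    have hj := comp_eq_zero j
    rw [selfDualEquiv_comp, ← map_neg] at hj
    exact ⟨neg_eq_zero.mp
        ((basicPart_incl_add 2 _ _).symm.trans ((congrArg _ hj).trans (map_zero _))),
      (fiberInt_incl_add 2 _ _).symm.trans ((congrArg _ hj).trans (map_zero _))⟩
  have bas_eq_zero := (components (k + 1)).2
  rw [add_sub_cancel_right] at bas_eq_zero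
  exact hk (eq_of_basicPart_of_fiberInt (bas_eq_zero.trans (map_zero _).symm)
    ((components k).1.trans (map_zero _).symm))

end SelfDuality

end IsDualityDatum

/-- Basic elements serve the odd degrees `n`, multiples of the fiber generator the even ones. -/
theorem exists_ext_d_ne_zero {g : Presentation} {ω : g.CE} (hω : ω ∈ g.homog (2 * 2, 0))
    (hz : ∀ n : ℕ, ∃ z ∈ g.homog (2 * n + 1, 0), g.d z ≠ 0) (m : ℤ) :
    ∃ (n k : ℤ) (y : (g.ext 2 ω hω).CE), n + 1 = 2 * 3 * k + m ∧
      y ∈ (g.ext 2 ω hω).homog (n, 0) ∧ (g.ext 2 ω hω).d y ≠ 0 := by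
  rcases Int.even_or_odd' m with ⟨l, rfl | rfl⟩
  · obtain ⟨z, hz, hdz⟩ := hz (3 * (l.natAbs + 1) + l - 1).toNat
    refine ⟨_, l.natAbs + 1, basicIncl g 2 z, by omega, basicIncl_mem g 2 hz, fun hdy => hdz ?_⟩
    rw [d_basicIncl] at hdy
    rw [← basicPart_basicIncl 2 (g.d z), hdy, map_zero]
  · obtain ⟨z, hz, hdz⟩ := hz (3 * (l.natAbs + 1) + l - 2).toNat
    have hy := incl_add_mem 2 rfl (zero_mem _) hz
    rw [Prod.mk_add_mk, add_zero] at hy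
    refine ⟨_, l.natAbs + 1, _, by omega, hy, fun hdy => hdz ?_⟩
    rw [d_incl_add] at hdy
    rw [← neg_eq_zero, ← fiberInt_incl_add 2 _ (-g.d z), hdy, map_zero]

namespace IsDualityDatum

variable {g : Presentation} {ω ω' K : g.CE} (D : IsDualityDatum g ω ω' K) (h : ω' = -ω)

theorem selfDualEquiv_nontrivial (hz : ∀ n : ℕ, ∃ z ∈ g.homog (2 * n + 1, 0), g.d z ≠ 0)
    (m : ℤ) : ∃ F k, ∀ (j : ℤ) (c : ℝ), (D.selfDualEquiv h m F).comp k ≠ c • F.comp j := by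
  obtain ⟨n, k, y, hn, hy, hdy⟩ := exists_ext_d_ne_zero D.mem_left hz m
  obtain ⟨F, hF⟩ :=
    TwistedCocycle.exists_comp_eq_d D.ext_isSuperLInfty D.extTwist_mem D.d_extTwist hn hy
  obtain ⟨k, hk⟩ := D.exists_selfDualEquiv_comp_ne_zero F h (hF ▸ hdy)
  exact ⟨F, k, TwistedCocycle.comp_ne_smul_comp (by omega) hk⟩

end IsDualityDatum

end Duality

/-! ### Spinors of Spin(9) -/

section Spin9

open Matrix

/-- Index set of a basis of the real spinor representation `16 = (ℝ²)^{⊗4}` of Spin(9). -/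
abbrev HalfIdx : Type := Fin 2 × Fin 2 × Fin 2 × Fin 2

/-- The four-fold Kronecker product. -/
def kron4 (A B C D : M₂) : Matrix HalfIdx HalfIdx ℝ := A ⊗ₖ (B ⊗ₖ (C ⊗ₖ D))

/-- The symmetric Clifford generators of Spin(9), normalised so that `Γ_i = γ_i ⊗ σ_x` for the
directions `i` other than the first and the last one. -/
def gam : Fin 9 → Matrix HalfIdx HalfIdx ℝ :=
  ![kron4 sE sE sE sE,
    kron4 1 sX sE sE,
    kron4 1 sZ sE sE,
    kron4 sX sE 1 sE,
    kron4 sZ sE 1 sE,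
    kron4 sE 1 sX sE,
    kron4 sE 1 sZ sE,
    kron4 1 1 1 sX,
    kron4 1 1 1 sZ]

/-- The polarization of `|(γ_i(x, x))_i| = |x|²`, the norm identity of the octonionic Hopf
fibration `S¹⁵ → S⁸`. -/
theorem sum_gam_mul_gam (x y : HalfIdx → ℝ) :
    ∑ i, (x ⬝ᵥ gam i *ᵥ x) * (x ⬝ᵥ gam i *ᵥ y) = (x ⬝ᵥ x) * (x ⬝ᵥ y) := by
  simp only [Fin.sum_univ_succ, Fin.sum_univ_zero, gam, kron4, dotProduct, mulVec,
    Fintype.sum_prod_type, sX, sZ, sE]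
  simp
  ring

/-- The decomposition `32 = 16 ⊗ 2` of the index set. -/
def spinorSplit : SpinorIdx ≃ HalfIdx × Fin 2 where
  toFun a := ((a.1, a.2.1, a.2.2.1, a.2.2.2.1), a.2.2.2.2)
  invFun a := (a.1.1, a.1.2.1, a.1.2.2.1, a.1.2.2.2, a.2)

/-- The Kronecker product of a `16 × 16` and a `2 × 2` matrix, acting on `32 = 16 ⊗ 2`. -/
def kronHalf (M : Matrix HalfIdx HalfIdx ℝ) (E : M₂) : Matrix SpinorIdx SpinorIdx ℝ :=
  (M ⊗ₖ E).submatrix spinorSplit spinorSplit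

theorem kronHalf_mul (M N : Matrix HalfIdx HalfIdx ℝ) (E F : M₂) :
    kronHalf M E * kronHalf N F = kronHalf (M * N) (E * F) := by
  rw [kronHalf, kronHalf, submatrix_mul_equiv, ← mul_kronecker_mul, kronHalf]

theorem kronHalf_transpose (M : Matrix HalfIdx HalfIdx ℝ) (E : M₂) :
    (kronHalf M E)ᵀ = kronHalf Mᵀ Eᵀ :=
  rfl

theorem kronHalf_neg (M : Matrix HalfIdx HalfIdx ℝ) (E : M₂) :
    kronHalf M (-E) = -kronHalf M E := by
  ext
  simp [kronHalf]

theorem kronHalf_add (M N : Matrix HalfIdx HalfIdx ℝ) (E : M₂) :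
    kronHalf (M + N) E = kronHalf M E + kronHalf N E := by
  ext
  simp [kronHalf, add_mul]

theorem kronHalf_one_one : kronHalf 1 1 = 1 := by
  rw [kronHalf, one_kronecker_one, submatrix_one_equiv]

theorem kronHalf_injective {E : M₂} (hE : E 0 0 ≠ 0) :
    Function.Injective fun M => kronHalf M E := by
  refine fun M N h => Matrix.ext fun i j => mul_right_cancel₀ hE ?_
  exact congrFun₂ h (spinorSplit.symm (i, 0)) (spinorSplit.symm (j, 0))

theorem kron5_eq_kronHalf (A B C D E : M₂) : kron5 A B C D E = kronHalf (kron4 A B C D) E := by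
  ext
  simp [kron5, kronHalf, kron4, spinorSplit, mul_assoc]

theorem kron4_one : kron4 1 1 1 1 = 1 := by
  simp only [kron4, one_kronecker_one]

theorem Gam_zero : Gam 0 = kronHalf 1 sE := by
  rw [← kron4_one]
  exact kron5_eq_kronHalf _ _ _ _ _

theorem Gam_castSucc_succ (i : Fin 9) : Gam i.castSucc.succ = kronHalf (gam i) sX := by
  fin_cases i <;> exact kron5_eq_kronHalf _ _ _ _ _

theorem Gam_last_succ : Gam (Fin.last 9).succ = kronHalf 1 sZ := by
  rw [← kron4_one]
  exact kron5_eq_kronHalf _ _ _ _ _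

theorem gam_transpose (i : Fin 9) : (gam i)ᵀ = gam i := by
  have h := Gam_skewAdjoint i.castSucc.succ
  obtain ⟨-, -, -, -, -, sX_sE, sE_sX, -, -⟩ := pauli
  rw [spinorMetric, Gam_zero, Gam_castSucc_succ, kronHalf_transpose, pauli_transpose.1,
    kronHalf_mul, kronHalf_mul, mul_one, one_mul, sX_sE, sE_sX, kronHalf_neg, neg_inj] at h
  exact kronHalf_injective (by simp [sZ]) h

theorem gam_clifford (i j : Fin 9) :
    gam i * gam j + gam j * gam i = if i = j then (2 : ℝ) • 1 else 0 := by
  refine kronHalf_injective (E := 1) (by simp) ?_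
  have h := Gam_clifford i.castSucc.succ j.castSucc.succ
  simp only [Gam_castSucc_succ, kronHalf_mul, pauli.1, ← kronHalf_add, Fin.succ_inj,
    Fin.castSucc_inj] at h
  refine h.trans ?_
  split_ifs with hij
  · simp [mink, two_smul, kronHalf_add, kronHalf_one_one]
  · ext
    simp [kronHalf]

theorem dotProduct_gam_comm (i : Fin 9) (x y : HalfIdx → ℝ) :
    x ⬝ᵥ gam i *ᵥ y = y ⬝ᵥ gam i *ᵥ x := by
  rw [dotProduct_mulVec, ← mulVec_transpose, gam_transpose, dotProduct_comm]

theorem dotProduct_gam_mul_gam (i j : Fin 9) (x y : HalfIdx → ℝ) :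
    x ⬝ᵥ (gam i * gam j) *ᵥ y =
      (if i = j then 2 * (x ⬝ᵥ y) else 0) - y ⬝ᵥ (gam i * gam j) *ᵥ x := by
  have swap : y ⬝ᵥ (gam i * gam j) *ᵥ x = x ⬝ᵥ (gam j * gam i) *ᵥ y := by
    rw [dotProduct_mulVec, ← mulVec_transpose, transpose_mul, gam_transpose, gam_transpose,
      dotProduct_comm]
  rw [swap, eq_sub_iff_add_eq, ← dotProduct_add, ← add_mulVec, gam_clifford]
  split_ifs
  · rw [smul_mulVec, one_mulVec, dotProduct_smul, smul_eq_mul]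
  · simp

end Spin9

/-! ### The Fierz identity for `Γ_{ab}` -/

section Fierz

open Matrix

theorem dotProduct_kronecker_mulVec {R l n : Type*} [CommSemiring R] [Fintype l] [Fintype n]
    (M : Matrix l l R) (E : Matrix n n R) (φ : l × n → R) :
    φ ⬝ᵥ (M ⊗ₖ E) *ᵥ φ =
      ∑ m, ∑ n, E m n * ((fun i => φ (i, m)) ⬝ᵥ M *ᵥ fun i => φ (i, n)) := by
  simp only [dotProduct, mulVec, Fintype.sum_prod_type_right, Finset.mul_sum, kroneckerMap_apply]
  refine Finset.sum_congr rfl fun m _ => ?_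
  rw [Finset.sum_comm]
  exact Finset.sum_congr rfl fun n _ => Finset.sum_congr rfl fun i _ =>
    Finset.sum_congr rfl fun j _ => by ring

variable (ψ : SpinorIdx → ℝ)

/-- The quadratic form `(ψ̄ M ψ)` of a spinor `ψ` with real components. -/
def spinorForm (M : Matrix SpinorIdx SpinorIdx ℝ) : ℝ :=
  ψ ⬝ᵥ (spinorMetric * M) *ᵥ ψ

/-- The two components of a spinor under `32 = 16 ⊗ 2`. -/
def half (m : Fin 2) : HalfIdx → ℝ := fun i => ψ (spinorSplit.symm (i, m))

theorem spinorForm_neg (M : Matrix SpinorIdx SpinorIdx ℝ) :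
    spinorForm ψ (-M) = -spinorForm ψ M := by
  simp [spinorForm, neg_mulVec]

theorem dotProduct_kronHalf_mulVec (M : Matrix HalfIdx HalfIdx ℝ) (E : M₂) :
    ψ ⬝ᵥ kronHalf M E *ᵥ ψ = ∑ m, ∑ n, E m n * (half ψ m ⬝ᵥ M *ᵥ half ψ n) := by
  rw [kronHalf, submatrix_mulVec_equiv, ← comp_equiv_symm_dotProduct, dotProduct_kronecker_mulVec]
  rfl

theorem spinorForm_kronHalf (M : Matrix HalfIdx HalfIdx ℝ) (E : M₂) :
    spinorForm ψ (kronHalf M E) = ∑ m, ∑ n, (sE * E) m n * (half ψ m ⬝ᵥ M *ᵥ half ψ n) := by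
  rw [spinorForm, spinorMetric, Gam_zero, kronHalf_mul, one_mul, dotProduct_kronHalf_mulVec]

theorem spinorForm_kronHalf_sE (M : Matrix HalfIdx HalfIdx ℝ) : spinorForm ψ (kronHalf M sE) =
    -(half ψ 0 ⬝ᵥ M *ᵥ half ψ 0 + half ψ 1 ⬝ᵥ M *ᵥ half ψ 1) := by
  rw [spinorForm_kronHalf, show sE * sE = -1 from pauli.2.2.1]
  simp only [Matrix.neg_apply, neg_mul, Fin.sum_univ_two, one_apply_eq,
    one_apply_ne (zero_ne_one (α := Fin 2)), one_apply_ne (one_ne_zero (α := Fin 2)), zero_mul,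
    one_mul]
  ring

theorem spinorForm_kronHalf_sX (M : Matrix HalfIdx HalfIdx ℝ) : spinorForm ψ (kronHalf M sX) =
    half ψ 0 ⬝ᵥ M *ᵥ half ψ 0 - half ψ 1 ⬝ᵥ M *ᵥ half ψ 1 := by
  rw [spinorForm_kronHalf, show sE * sX = sZ from pauli.2.2.2.2.2.2.1]
  simp [sZ, sub_eq_add_neg]

theorem spinorForm_kronHalf_sZ (M : Matrix HalfIdx HalfIdx ℝ) : spinorForm ψ (kronHalf M sZ) =
    -(half ψ 0 ⬝ᵥ M *ᵥ half ψ 1 + half ψ 1 ⬝ᵥ M *ᵥ half ψ 0) := by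
  rw [spinorForm_kronHalf, show sE * sZ = -sX from pauli.2.2.2.2.2.2.2.2]
  simp only [sX, Matrix.neg_apply, of_apply, cons_val', cons_val_fin_one, Fin.sum_univ_two,
    cons_val_zero, cons_val_one, neg_mul, one_mul, zero_mul]
  ring

theorem spinorForm_kronHalf_one (M : Matrix HalfIdx HalfIdx ℝ) : spinorForm ψ (kronHalf M 1) =
    half ψ 0 ⬝ᵥ M *ᵥ half ψ 1 - half ψ 1 ⬝ᵥ M *ᵥ half ψ 0 := by
  rw [spinorForm_kronHalf, mul_one]
  simp [sE, sub_eq_add_neg]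

theorem sum_spinorForm_Gam_mul_matrix (B : Matrix SpinorIdx SpinorIdx ℝ) :
    ∑ a, mink a * spinorForm ψ (Gam a) * spinorForm ψ (Gam a * B) =
      (half ψ 0 ⬝ᵥ half ψ 0 + half ψ 1 ⬝ᵥ half ψ 1) * spinorForm ψ (kronHalf 1 sE * B)
      + (∑ i, (half ψ 0 ⬝ᵥ gam i *ᵥ half ψ 0 - half ψ 1 ⬝ᵥ gam i *ᵥ half ψ 1)
          * spinorForm ψ (kronHalf (gam i) sX * B)
        - 2 * (half ψ 0 ⬝ᵥ half ψ 1) * spinorForm ψ (kronHalf 1 sZ * B)) := by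
  have mink_zero : mink 0 = -1 := by simp [mink]
  have mink_succ (i : Fin 10) : mink i.succ = 1 := by simp [mink]
  rw [Fin.sum_univ_succ, Fin.sum_univ_castSucc]
  simp only [mink_zero, mink_succ, Gam_zero, Gam_castSucc_succ, Gam_last_succ,
    spinorForm_kronHalf_sE, spinorForm_kronHalf_sX, spinorForm_kronHalf_sZ, one_mulVec, one_mul,
    dotProduct_comm (half ψ 1) (half ψ 0)]
  ring

theorem sum_spinorForm_Gam_mul_Gam_zero :
    ∑ a, mink a * spinorForm ψ (Gam a) * spinorForm ψ (Gam a * Gam 0) = 0 := by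
  obtain ⟨-, -, sE_sE, -, -, sX_sE, -, sZ_sE, -⟩ := pauli
  rw [sum_spinorForm_Gam_mul_matrix, Gam_zero]
  simp only [kronHalf_mul, mul_one, sE_sE, sX_sE, sZ_sE, kronHalf_neg, spinorForm_neg,
    spinorForm_kronHalf_one, spinorForm_kronHalf_sX, spinorForm_kronHalf_sZ, one_mulVec]
  have split (i : Fin 9) : (half ψ 0 ⬝ᵥ gam i *ᵥ half ψ 0 - half ψ 1 ⬝ᵥ gam i *ᵥ half ψ 1)
        * - -(half ψ 0 ⬝ᵥ gam i *ᵥ half ψ 1 + half ψ 1 ⬝ᵥ gam i *ᵥ half ψ 0) =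
      2 * ((half ψ 0 ⬝ᵥ gam i *ᵥ half ψ 0) * (half ψ 0 ⬝ᵥ gam i *ᵥ half ψ 1))
        - 2 * ((half ψ 1 ⬝ᵥ gam i *ᵥ half ψ 1) * (half ψ 1 ⬝ᵥ gam i *ᵥ half ψ 0)) := by
    rw [dotProduct_gam_comm i (half ψ 1) (half ψ 0)]
    ring
  simp only [split, Finset.sum_sub_distrib, ← Finset.mul_sum, sum_gam_mul_gam,
    dotProduct_comm (half ψ 1) (half ψ 0)]
  ring

theorem sum_spinorForm_Gam_mul_Gam_castSucc_succ (j : Fin 9) :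
    ∑ a, mink a * spinorForm ψ (Gam a) * spinorForm ψ (Gam a * Gam j.castSucc.succ) = 0 := by
  obtain ⟨sX_sX, -, -, -, sZ_sX, -, sE_sX, -, -⟩ := pauli
  rw [sum_spinorForm_Gam_mul_matrix, Gam_castSucc_succ]
  simp only [kronHalf_mul, one_mul, sX_sX, sZ_sX, sE_sX, spinorForm_kronHalf_one,
    spinorForm_kronHalf_sE, spinorForm_kronHalf_sZ]
  have split (i : Fin 9) : (half ψ 0 ⬝ᵥ gam i *ᵥ half ψ 0 - half ψ 1 ⬝ᵥ gam i *ᵥ half ψ 1)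
        * (half ψ 0 ⬝ᵥ (gam i * gam j) *ᵥ half ψ 1 - half ψ 1 ⬝ᵥ (gam i * gam j) *ᵥ half ψ 0) =
      2 * ((half ψ 0 ⬝ᵥ gam i *ᵥ half ψ 0) * (half ψ 0 ⬝ᵥ gam i *ᵥ (gam j *ᵥ half ψ 1)))
        + 2 * ((half ψ 1 ⬝ᵥ gam i *ᵥ half ψ 1) * (half ψ 1 ⬝ᵥ gam i *ᵥ (gam j *ᵥ half ψ 0)))
        - if i = j then 2 * (half ψ 0 ⬝ᵥ half ψ 1)
          * (half ψ 0 ⬝ᵥ gam i *ᵥ half ψ 0 + half ψ 1 ⬝ᵥ gam i *ᵥ half ψ 1) else 0 := by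
    rw [mulVec_mulVec, mulVec_mulVec, dotProduct_gam_mul_gam i j (half ψ 0) (half ψ 1)]
    split_ifs <;> ring
  simp only [split, Finset.sum_sub_distrib, Finset.sum_add_distrib, ← Finset.mul_sum,
    sum_gam_mul_gam, dotProduct_gam_comm j (half ψ 1) (half ψ 0), Finset.sum_ite_eq',
    Finset.mem_univ, if_true]
  ring

theorem sum_spinorForm_Gam_mul_Gam_last_succ :
    ∑ a, mink a * spinorForm ψ (Gam a) * spinorForm ψ (Gam a * Gam (Fin.last 9).succ) = 0 := by
  obtain ⟨-, sZ_sZ, -, sX_sZ, -, -, -, -, sE_sZ⟩ := pauli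
  rw [sum_spinorForm_Gam_mul_matrix, Gam_last_succ]
  simp only [kronHalf_mul, mul_one, sZ_sZ, sX_sZ, sE_sZ, kronHalf_neg, spinorForm_neg,
    spinorForm_kronHalf_one, spinorForm_kronHalf_sE, spinorForm_kronHalf_sX, one_mulVec]
  have split (i : Fin 9) : (half ψ 0 ⬝ᵥ gam i *ᵥ half ψ 0 - half ψ 1 ⬝ᵥ gam i *ᵥ half ψ 1)
        * - -(half ψ 0 ⬝ᵥ gam i *ᵥ half ψ 0 + half ψ 1 ⬝ᵥ gam i *ᵥ half ψ 1) =
      (half ψ 0 ⬝ᵥ gam i *ᵥ half ψ 0) * (half ψ 0 ⬝ᵥ gam i *ᵥ half ψ 0)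
        - (half ψ 1 ⬝ᵥ gam i *ᵥ half ψ 1) * (half ψ 1 ⬝ᵥ gam i *ᵥ half ψ 1) := by
    ring
  simp only [split, Finset.sum_sub_distrib, sum_gam_mul_gam,
    dotProduct_comm (half ψ 1) (half ψ 0)]
  ring

theorem sum_spinorForm_Gam_mul_Gam (b : Fin 11) :
    ∑ a, mink a * spinorForm ψ (Gam a) * spinorForm ψ (Gam a * Gam b) = 0 := by
  rcases Fin.eq_zero_or_eq_succ b with rfl | ⟨b, rfl⟩
  · exact sum_spinorForm_Gam_mul_Gam_zero ψ
  rcases Fin.eq_castSucc_or_eq_last b with ⟨j, rfl⟩ | rfl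
  · exact sum_spinorForm_Gam_mul_Gam_castSucc_succ ψ j
  · exact sum_spinorForm_Gam_mul_Gam_last_succ ψ

end Fierz

section SpinorAdjoint

open Matrix

/-- The adjoint `M ↦ M̄` with respect to the spinor pairing, the sign being that of the inverse
`-spinorMetric` of `spinorMetric`. -/
def spinorAdj (M : Matrix SpinorIdx SpinorIdx ℝ) : Matrix SpinorIdx SpinorIdx ℝ :=
  -(spinorMetric * Mᵀ * spinorMetric)

theorem spinorMetric_mul_self : spinorMetric * spinorMetric = -1 := by
  rw [spinorMetric, Gam_zero, kronHalf_mul, mul_one, pauli.2.2.1, kronHalf_neg, kronHalf_one_one]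

theorem spinorMetric_mul_spinorAdj (M : Matrix SpinorIdx SpinorIdx ℝ) :
    spinorMetric * spinorAdj M = Mᵀ * spinorMetric := by
  rw [spinorAdj, mul_neg, ← mul_assoc, ← mul_assoc, spinorMetric_mul_self, neg_one_mul, neg_mul,
    neg_neg]

theorem spinorAdj_mul (M N : Matrix SpinorIdx SpinorIdx ℝ) :
    spinorAdj (M * N) = spinorAdj N * spinorAdj M := by
  have regroup : spinorMetric * Nᵀ * spinorMetric * (spinorMetric * Mᵀ * spinorMetric) =
      spinorMetric * Nᵀ * (spinorMetric * spinorMetric) * Mᵀ * spinorMetric := by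
    noncomm_ring
  rw [spinorAdj, spinorAdj, spinorAdj, neg_mul_neg, regroup, spinorMetric_mul_self, transpose_mul]
  noncomm_ring

theorem spinorAdj_Gam (a : Fin 11) : spinorAdj (Gam a) = -Gam a := by
  rw [spinorAdj, mul_assoc, Gam_skewAdjoint, mul_neg, ← mul_assoc, spinorMetric_mul_self]
  simp

theorem spinorAdj_one : spinorAdj 1 = 1 := by
  rw [spinorAdj, transpose_one, mul_one, spinorMetric_mul_self, neg_neg]

/-- The components of the Minkowski metric. -/
def minkMetric (a b : Fin 11) : ℝ := if a = b then mink a else 0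

theorem minkMetric_comm (a b : Fin 11) : minkMetric a b = minkMetric b a := by
  rcases eq_or_ne a b with rfl | h
  · rfl
  · rw [minkMetric, minkMetric, if_neg h, if_neg h.symm]

theorem sum_minkMetric_smul {V : Type*} [AddCommGroup V] [Module ℝ V] (c : Fin 11)
    (f : Fin 11 → V) : ∑ a, (mink a * minkMetric a c) • f a = f c := by
  have mink_mul_self : mink c * mink c = 1 := by
    rw [mink]
    split_ifs <;> norm_num
  simp [minkMetric, mink_mul_self]

theorem Gam_mul_Gam (a b : Fin 11) :
    Gam a * Gam b = (2 * minkMetric a b) • 1 - Gam b * Gam a := by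
  rw [eq_sub_iff_add_eq, Gam_clifford, minkMetric]
  split_ifs <;> simp

theorem Gam_mul_Gam_mul (a b : Fin 11) (M : Matrix SpinorIdx SpinorIdx ℝ) :
    Gam a * (Gam b * M) = (2 * minkMetric a b) • M - Gam b * (Gam a * M) := by
  rw [← mul_assoc, Gam_mul_Gam, sub_mul, smul_mul_assoc, one_mul, mul_assoc]

theorem Gam_mul_Gam_of_ne {a b : Fin 11} (h : a ≠ b) : Gam a * Gam b = -(Gam b * Gam a) := by
  rw [Gam_mul_Gam, minkMetric, if_neg h, mul_zero, zero_smul, zero_sub]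

theorem Gam_mul_Gam_mul_Gam_reverse {a b c : Fin 11} (hab : a ≠ b) (hac : a ≠ c) (hbc : b ≠ c) :
    Gam c * (Gam b * Gam a) = -(Gam a * (Gam b * Gam c)) := by
  rw [Gam_mul_Gam_of_ne hab.symm, mul_neg, ← mul_assoc, Gam_mul_Gam_of_ne hac.symm, neg_mul,
    mul_assoc, Gam_mul_Gam_of_ne hbc.symm, mul_neg, neg_neg]

end SpinorAdjoint

/-! ### Spinor bilinears as polynomials -/

section BilinPoly

open Matrix

/-- The spinor bilinear `(ψ̄ M ψ)` as a polynomial in the components of a commuting spinor. -/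
def bilinPoly : Matrix SpinorIdx SpinorIdx ℝ →ₗ[ℝ] MvPolynomial SpinorIdx ℝ where
  toFun M := MvPolynomial.X ⬝ᵥ (spinorMetric * M).map MvPolynomial.C *ᵥ MvPolynomial.X
  map_add' M N := by
    rw [mul_add, Matrix.map_add _ (map_add _), add_mulVec, dotProduct_add]
  map_smul' r M := by
    rw [mul_smul_comm, Matrix.map_smul _ r fun t => by rw [smul_eq_mul, map_mul,
      MvPolynomial.smul_eq_C_mul], smul_mulVec, dotProduct_smul, RingHom.id_apply]

theorem bilinPoly_apply (M : Matrix SpinorIdx SpinorIdx ℝ) : bilinPoly M =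
    MvPolynomial.X ⬝ᵥ (spinorMetric * M).map MvPolynomial.C *ᵥ MvPolynomial.X :=
  rfl

theorem eval_bilinPoly (ψ : SpinorIdx → ℝ) (M : Matrix SpinorIdx SpinorIdx ℝ) :
    MvPolynomial.eval ψ (bilinPoly M) = spinorForm ψ M := by
  simp [bilinPoly_apply, spinorForm, dotProduct, mulVec]

theorem bilinPoly_spinorAdj (M : Matrix SpinorIdx SpinorIdx ℝ) :
    bilinPoly (spinorAdj M) = -bilinPoly M := by
  have transposed : spinorMetric * spinorAdj M = (-(spinorMetric * M))ᵀ := by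
    rw [spinorMetric_mul_spinorAdj, transpose_neg, transpose_mul, spinorMetric_skew, mul_neg,
      neg_neg]
  rw [← map_neg, bilinPoly_apply, bilinPoly_apply, transposed, mul_neg, transpose_map,
    mulVec_transpose, dotProduct_comm, dotProduct_mulVec]

theorem bilinPoly_eq_zero_of_spinorAdj_eq {M : Matrix SpinorIdx SpinorIdx ℝ}
    (h : spinorAdj M = M) : bilinPoly M = 0 := by
  have skew := bilinPoly_spinorAdj M
  rw [h] at skew
  exact self_eq_neg.mp skew

theorem bilinPoly_one : bilinPoly 1 = 0 :=
  bilinPoly_eq_zero_of_spinorAdj_eq spinorAdj_one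

theorem bilinPoly_Gam_mul_Gam_swap (a b : Fin 11) :
    bilinPoly (Gam a * Gam b) = -bilinPoly (Gam b * Gam a) := by
  rw [Gam_mul_Gam, map_sub, map_smul, bilinPoly_one, smul_zero, zero_sub]

theorem bilinPoly_Gam_three {a b c : Fin 11} (hab : a ≠ b) (hac : a ≠ c) (hbc : b ≠ c) :
    bilinPoly (Gam a * (Gam b * Gam c)) = 0 := by
  refine bilinPoly_eq_zero_of_spinorAdj_eq ?_
  simp only [spinorAdj_mul, spinorAdj_Gam, neg_mul, mul_neg, neg_neg, mul_assoc]
  rw [Gam_mul_Gam_mul_Gam_reverse hab hac hbc, neg_neg]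

theorem bilinPoly_mul_Gam_mul_Gam_swap {M N : Matrix SpinorIdx SpinorIdx ℝ}
    (h : bilinPoly (M * N) = 0) (a b : Fin 11) :
    bilinPoly (M * (Gam a * (Gam b * N))) = -bilinPoly (M * (Gam b * (Gam a * N))) := by
  rw [Gam_mul_Gam_mul, mul_sub, map_sub, mul_smul_comm, map_smul, h, smul_zero, zero_sub]

theorem spinorAdj_Gam_four (a : Fin 11) {b c d : Fin 11} (hbc : b ≠ c) (hbd : b ≠ d)
    (hcd : c ≠ d) : spinorAdj (Gam a * (Gam b * (Gam c * Gam d))) =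
      Gam a * (Gam b * (Gam c * Gam d)) + (2 * minkMetric a d) • (Gam c * Gam b)
        - (2 * minkMetric a c) • (Gam d * Gam b) + (2 * minkMetric a b) • (Gam d * Gam c) := by
  simp only [spinorAdj_mul, spinorAdj_Gam, neg_mul, mul_neg, neg_neg, mul_assoc]
  have move_three : Gam c * (Gam b * Gam a) = (2 * minkMetric a b) • Gam c
      - (2 * minkMetric a c) • Gam b + Gam a * (Gam c * Gam b) := by
    rw [Gam_mul_Gam b a, mul_sub, Gam_mul_Gam_mul c a, minkMetric_comm b, minkMetric_comm c,
      mul_smul_comm, mul_one]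
    module
  rw [move_three, mul_add, mul_sub, Gam_mul_Gam_mul d a,
    Gam_mul_Gam_mul_Gam_reverse hbc hbd hcd, minkMetric_comm d, mul_smul_comm, mul_smul_comm,
    mul_neg]
  module

theorem bilinPoly_Gam_four (a : Fin 11) {b c d : Fin 11} (hbc : b ≠ c) (hbd : b ≠ d)
    (hcd : c ≠ d) : bilinPoly (Gam a * (Gam b * (Gam c * Gam d))) =
      minkMetric a b • bilinPoly (Gam c * Gam d) - minkMetric a c • bilinPoly (Gam b * Gam d)
        + minkMetric a d • bilinPoly (Gam b * Gam c) := by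
  have skew := bilinPoly_spinorAdj (Gam a * (Gam b * (Gam c * Gam d)))
  rw [spinorAdj_Gam_four a hbc hbd hcd] at skew
  simp only [map_add, map_sub, map_smul, bilinPoly_Gam_mul_Gam_swap c b,
    bilinPoly_Gam_mul_Gam_swap d b, bilinPoly_Gam_mul_Gam_swap d c] at skew
  linear_combination (norm := module) (2⁻¹ : ℝ) • skew

theorem sum_bilinPoly_Gam_mul_Gam (b : Fin 11) :
    ∑ a, mink a • (bilinPoly (Gam a) * bilinPoly (Gam a * Gam b)) = 0 := by
  refine MvPolynomial.funext fun ψ => ?_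
  simp only [map_sum, MvPolynomial.smul_eval, map_mul, eval_bilinPoly, map_zero, ← mul_assoc]
  exact sum_spinorForm_Gam_mul_Gam ψ b

/-- The variation `δψ = N ψ` of a commuting spinor, as a derivation. -/
def spinVariation (N : Matrix SpinorIdx SpinorIdx ℝ) :
    Derivation ℝ (MvPolynomial SpinorIdx ℝ) (MvPolynomial SpinorIdx ℝ) :=
  MvPolynomial.mkDerivation ℝ (N.map MvPolynomial.C *ᵥ MvPolynomial.X)

theorem derivation_dotProduct_mulVec {R A ι : Type*} [CommSemiring R] [CommSemiring A] [Algebra R A]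
    [Fintype ι] (D : Derivation R A A) (M : Matrix ι ι R) (x : ι → A) :
    D (x ⬝ᵥ M.map (algebraMap R A) *ᵥ x) =
      x ⬝ᵥ M.map (algebraMap R A) *ᵥ (D ∘ x) + (D ∘ x) ⬝ᵥ M.map (algebraMap R A) *ᵥ x := by
  simp [dotProduct, mulVec, Finset.sum_add_distrib, mul_comm]

theorem spinVariation_bilinPoly (N M : Matrix SpinorIdx SpinorIdx ℝ) :
    spinVariation N (bilinPoly M) = bilinPoly (M * N) + bilinPoly (spinorAdj N * M) := by
  have variation_X : spinVariation N ∘ MvPolynomial.X = N.map MvPolynomial.C *ᵥ MvPolynomial.X :=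
    funext fun α => MvPolynomial.mkDerivation_X ℝ _ α
  rw [bilinPoly_apply]
  refine (derivation_dotProduct_mulVec _ _ _).trans ?_
  rw [variation_X]
  refine congrArg₂ (· + ·) ?_ ?_
  · rw [MvPolynomial.algebraMap_eq, mulVec_mulVec, ← Matrix.map_mul, mul_assoc, bilinPoly_apply]
  · rw [MvPolynomial.algebraMap_eq, bilinPoly_apply, ← mul_assoc, spinorMetric_mul_spinorAdj,
      mul_assoc, Matrix.map_mul (L := Nᵀ), ← mulVec_mulVec, dotProduct_mulVec _ (Nᵀ.map _),
      transpose_map, vecMul_transpose]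

theorem spinVariation_bilinPoly_Gam (N : Matrix SpinorIdx SpinorIdx ℝ) (a : Fin 11) :
    spinVariation N (bilinPoly (Gam a)) = (2 : ℝ) • bilinPoly (Gam a * N) := by
  have skew := bilinPoly_spinorAdj (Gam a * N)
  rw [spinorAdj_mul, spinorAdj_Gam, mul_neg, map_neg, neg_inj] at skew
  rw [spinVariation_bilinPoly, skew]
  exact (two_smul ℝ _).symm

theorem spinVariation_bilinPoly_Gam_mul_Gam {N : Matrix SpinorIdx SpinorIdx ℝ}
    (hN : bilinPoly N = 0) (a b : Fin 11) : spinVariation N (bilinPoly (Gam a * Gam b)) =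
      (2 : ℝ) • bilinPoly (Gam a * (Gam b * N)) := by
  have skew := bilinPoly_spinorAdj (Gam b * (Gam a * N))
  have swap := bilinPoly_mul_Gam_mul_Gam_swap (congrArg bilinPoly (one_mul N) |>.trans hN) b a
  rw [one_mul, one_mul] at swap
  rw [spinorAdj_mul, spinorAdj_mul, spinorAdj_Gam, spinorAdj_Gam, mul_assoc, neg_mul_neg, swap,
    neg_neg] at skew
  rw [spinVariation_bilinPoly, skew, mul_assoc]
  exact (two_smul ℝ _).symm

/-- The Fierz identity `(ψ̄ Γ^a ψ) (ψ̄ Γ_{abcde} ψ) = 3 (ψ̄ Γ_{[bc} ψ) (ψ̄ Γ_{de]} ψ)` is the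
variation of `(ψ̄ Γ^a ψ) (ψ̄ Γ_{ab} ψ) = 0` along `δψ = Γ_{cde} ψ`. -/
theorem sum_bilinPoly_Gam_mul_Gam_five (b : Fin 11) {c d e : Fin 11}
    (hcd : c ≠ d) (hce : c ≠ e) (hde : d ≠ e) :
    ∑ a, mink a • (bilinPoly (Gam a)
        * bilinPoly (Gam a * (Gam b * (Gam c * (Gam d * Gam e))))) =
      bilinPoly (Gam b * Gam c) * bilinPoly (Gam d * Gam e)
      - bilinPoly (Gam b * Gam d) * bilinPoly (Gam c * Gam e)
      + bilinPoly (Gam b * Gam e) * bilinPoly (Gam c * Gam d) := by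
  have variation := congrArg (spinVariation (Gam c * (Gam d * Gam e))) (sum_bilinPoly_Gam_mul_Gam b)
  rw [map_sum, map_zero] at variation
  simp only [Derivation.map_smul, Derivation.leibniz, spinVariation_bilinPoly_Gam,
    spinVariation_bilinPoly_Gam_mul_Gam (bilinPoly_Gam_three hcd hce hde),
    bilinPoly_Gam_four _ hcd hce hde] at variation
  have contract (x : Fin 11) (p : MvPolynomial SpinorIdx ℝ) : bilinPoly (Gam b * Gam x) * p =
      -∑ a, (mink a * minkMetric a x) • (bilinPoly (Gam a * Gam b) * p) := by
    rw [sum_minkMetric_smul x fun a => bilinPoly (Gam a * Gam b) * p, bilinPoly_Gam_mul_Gam_swap,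
      neg_mul]
  refine smul_right_injective _ (two_ne_zero (α := ℝ)) (sub_eq_zero.mp ?_)
  simp only [contract, ← Finset.sum_neg_distrib, ← Finset.sum_sub_distrib,
    ← Finset.sum_add_distrib, Finset.smul_sum]
  rw [← variation]
  refine Finset.sum_congr rfl fun a _ => ?_
  simp only [smul_eq_mul, mul_smul_comm, mul_add, mul_sub]
  module

end BilinPoly

/-! ### The differential on super-Minkowski spacetime -/

section SuperMinkowski

open Presentation

theorem psi_comm (α β : SpinorIdx) : psi α * psi β = psi β * psi α := by
  have graded_comm := gen_mul_gen (deg := minkDeg) (.psi α) (.psi β)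
  have koszul_eq_one : koszul (minkDeg (.psi α)) (minkDeg (.psi β)) = 1 := by
    simp [koszul, minkDeg, ZMod.val_one]
  rwa [koszul_eq_one, one_smul] at graded_comm

open scoped IsMulCommutative in
/-- The algebra map from polynomials to the subalgebra generated by the commuting `ψ^α`, through
which polynomial identities between spinor bilinears enter the Chevalley–Eilenberg algebra. -/
def psiPoly : MvPolynomial SpinorIdx ℝ →ₐ[ℝ] GCA minkDeg :=
  haveI : IsMulCommutative (Algebra.adjoin ℝ (Set.range psi)) :=
    Algebra.isMulCommutative_adjoin ℝ (by
      rintro _ ⟨α, rfl⟩ _ ⟨β, rfl⟩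
      exact psi_comm α β)
  (Algebra.adjoin ℝ (Set.range psi)).val.comp
    (MvPolynomial.aeval fun α => ⟨psi α, Algebra.subset_adjoin ⟨α, rfl⟩⟩)

theorem psiPoly_X (α : SpinorIdx) : psiPoly (MvPolynomial.X α) = psi α := by
  simp [psiPoly]

theorem psiPoly_bilinPoly (M : Matrix SpinorIdx SpinorIdx ℝ) :
    psiPoly (bilinPoly M) = bilin M := by
  simp only [bilinPoly_apply, bilin, dotProduct, Matrix.mulVec, Matrix.map_apply, map_sum, map_mul,
    psiPoly_X, Finset.mul_sum, ← MvPolynomial.algebraMap_eq, AlgHom.commutes, Algebra.smul_def]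
  refine Finset.sum_congr rfl fun α _ => Finset.sum_congr rfl fun γ _ => ?_
  exact Algebra.left_comm (psi α) ((spinorMetric * M) α γ) (psi γ)

theorem commute_bilin (M : Matrix SpinorIdx SpinorIdx ℝ) (x : GCA minkDeg) :
    Commute (bilin M) x :=
  commute_of_mem_even even_two (bilin_mem M) x

theorem d_psi (α : SpinorIdx) : superMink.d (psi α) = 0 :=
  d_gen (g := superMink) (.psi α)

theorem d_vielb (a : Fin 11) : superMink.d (vielb a) = mink a • bilin (Gam a) := by
  refine (d_gen (g := superMink) (.e a)).trans ?_
  change bilin _ = _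
  rw [← psiPoly_bilinPoly, map_smul, map_smul, psiPoly_bilinPoly]

theorem d_bilin (M : Matrix SpinorIdx SpinorIdx ℝ) : superMink.d (bilin M) = 0 := by
  rw [bilin, map_sum]
  refine Finset.sum_eq_zero fun _ _ => ?_
  rw [map_sum]
  refine Finset.sum_eq_zero fun _ _ => ?_
  rw [map_smul, d_mul, d_psi, d_psi, zero_mul, mul_zero, add_zero, smul_zero]

theorem superMink_isSuperLInfty : superMink.IsSuperLInfty := by
  refine isSuperLInfty_of_gen ?_
  rintro (_ | _)
  · exact map_zero _
  · exact d_bilin _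

end SuperMinkowski

/-! ### Forms contracted with products of the vielbein -/

section VielbeinForms

variable {n : ℕ}

/-- The product `Γ_{a_1} ⋯ Γ_{a_n}`, not skew-symmetrized. -/
def gamProd (a : Fin n → Fin 11) : Matrix SpinorIdx SpinorIdx ℝ :=
  (List.ofFn fun i => Gam (a i)).prod

/-- The product `e^{a_1} ⋯ e^{a_n}`. -/
def vielbProd (a : Fin n → Fin 11) : GCA minkDeg :=
  (List.ofFn fun i => vielb (a i)).prod

/-- The form `(ψ̄ Γ_{a_1 ⋯ a_n} ψ) e^{a_1} ⋯ e^{a_n}`. The products of gamma matrices need not be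
skew-symmetrized, see `sum_bilin_GamSkew`. -/
def bilinForm (n : ℕ) : GCA minkDeg :=
  ∑ a : Fin n → Fin 11, bilin (gamProd a) * vielbProd a

theorem gamProd_succ (a : Fin (n + 1) → Fin 11) :
    gamProd a = Gam (a 0) * gamProd (Fin.tail a) := by
  rw [gamProd, List.ofFn_succ, List.prod_cons]
  rfl

theorem gamProd_cons (x : Fin 11) (a : Fin n → Fin 11) :
    gamProd (Fin.cons x a : Fin (n + 1) → Fin 11) = Gam x * gamProd a :=
  gamProd_succ _

theorem vielbProd_comp_perm (a : Fin n → Fin 11) (σ : Equiv.Perm (Fin n)) :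
    vielbProd (a ∘ σ) = Equiv.Perm.sign σ • vielbProd a :=
  prod_ofFn_comp_perm (x := fun i => vielb (a i)) odd_one (fun i => vielb_mem (a i)) σ

theorem vielbProd_eq_zero {a : Fin n → Fin 11} (ha : ¬Function.Injective a) : vielbProd a = 0 :=
  prod_ofFn_eq_zero odd_one (fun i => vielb_mem (a i)) fun h => ha (.of_comp (f := vielb) h)

theorem vielbProd_append {m : ℕ} (a : Fin m → Fin 11) (b : Fin n → Fin 11) :
    vielbProd (Fin.append a b) = vielbProd a * vielbProd b := by
  rw [vielbProd, vielbProd, vielbProd, ← List.prod_append, ← List.ofFn_fin_append]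
  congr 2
  funext i
  refine Fin.addCases (fun j => ?_) (fun j => ?_) i <;> simp

theorem sum_mul_vielbProd_comp_perm (f : (Fin n → Fin 11) → GCA minkDeg)
    (σ : Equiv.Perm (Fin n)) : ∑ a, f (a ∘ σ) * vielbProd a =
      Equiv.Perm.sign σ • ∑ a, f a * vielbProd a := by
  rw [← Equiv.sum_comp (Equiv.arrowCongr σ.symm (Equiv.refl (Fin 11))) fun a => f a * vielbProd a,
    Finset.smul_sum]
  refine Finset.sum_congr rfl fun a _ => ?_
  change _ = Equiv.Perm.sign σ • (f (a ∘ σ) * vielbProd (a ∘ σ))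
  rw [vielbProd_comp_perm, mul_smul_comm, smul_smul, Int.units_mul_self, one_smul]

theorem sum_bilin_GamSkew (n : ℕ) :
    ∑ a : Fin n → Fin 11, bilin (GamSkew a) * (List.ofFn fun i => vielb (a i)).prod =
      bilinForm n := by
  have expand (a : Fin n → Fin 11) : bilin (GamSkew a) * vielbProd a =
      (n.factorial : ℝ)⁻¹ • ∑ σ : Equiv.Perm (Fin n),
        Equiv.Perm.sign σ • (bilin (gamProd (a ∘ σ)) * vielbProd a) := by
    rw [← psiPoly_bilinPoly, GamSkew, map_smul, map_smul, map_sum, map_sum, smul_mul_assoc,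
      Finset.sum_mul]
    refine congrArg _ (Finset.sum_congr rfl fun σ _ => ?_)
    rw [map_smul, map_smul, psiPoly_bilinPoly, Int.cast_smul_eq_zsmul, smul_mul_assoc]
    rfl
  have contract (σ : Equiv.Perm (Fin n)) : ∑ a : Fin n → Fin 11,
      Equiv.Perm.sign σ • (bilin (gamProd (a ∘ σ)) * vielbProd a) = bilinForm n := by
    rw [← Finset.smul_sum, sum_mul_vielbProd_comp_perm (fun a => bilin (gamProd a)), smul_smul,
      Int.units_mul_self, one_smul, bilinForm]
  refine (Finset.sum_congr rfl fun a _ => expand a).trans ?_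
  rw [← Finset.smul_sum, Finset.sum_comm]
  simp only [contract, Finset.sum_const, Finset.card_univ, Fintype.card_perm, Fintype.card_fin]
  rw [← Nat.cast_smul_eq_nsmul ℝ, smul_smul, inv_mul_cancel₀ (Nat.cast_ne_zero.mpr
    (Nat.factorial_ne_zero n)), one_smul]

theorem d_bilinForm (n : ℕ) : superMink.d (bilinForm (n + 1)) =
    ∑ i : Fin (n + 1), (-1 : ℝ) ^ (i : ℕ) • ∑ a : Fin n → Fin 11,
      (∑ x, mink x • (bilin (Gam x) * bilin (gamProd (i.insertNth x a)))) * vielbProd a := by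
  have d_summand (a : Fin (n + 1) → Fin 11) : superMink.d (bilin (gamProd a) * vielbProd a) =
      ∑ i : Fin (n + 1), (-1 : ℝ) ^ (i : ℕ) •
        (mink (a i) • (bilin (Gam (a i)) * bilin (gamProd a)) * vielbProd (i.removeNth a)) := by
    rw [Presentation.d_mul_of_closed (g := superMink) even_two (bilin_mem _) (d_bilin _), vielbProd,
      Presentation.d_prod_ofFn (g := superMink) odd_one _ fun i => vielb_mem (a i),
      Finset.mul_sum]
    refine Finset.sum_congr rfl fun i _ => ?_
    rw [d_vielb, mul_smul_comm, ← mul_assoc, mul_smul_comm, (commute_bilin _ _).eq]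
    rfl
  rw [bilinForm, map_sum, Finset.sum_congr rfl fun a _ => d_summand a, Finset.sum_comm]
  refine Finset.sum_congr rfl fun i _ => ?_
  rw [← Finset.smul_sum, ← (Fin.insertNthEquiv (fun _ => Fin 11) i).sum_comp,
    Fintype.sum_prod_type, Finset.sum_comm]
  simp [Finset.sum_mul, Fin.insertNthEquiv]

/-- Moving `Γ_x` past `Γ_{a_j}` leaves a contraction in which both factors are gone; `h` annihilates
it. -/
theorem bilinPoly_mul_gamProd_insertNth {n : ℕ} {M : Matrix SpinorIdx SpinorIdx ℝ}
    {a : Fin (n + 1) → Fin 11}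
    (h : ∀ j : Fin (n + 1), bilinPoly (M * gamProd (j.removeNth a)) = 0)
    (i : Fin (n + 2)) (x : Fin 11) : bilinPoly (M * gamProd (i.insertNth x a)) =
      (-1 : ℝ) ^ (i : ℕ) • bilinPoly (M * (Gam x * gamProd a)) := by
  refine Fin.cases ?_ (fun i => ?_) i
  · rw [Fin.insertNth_zero', gamProd_cons, Fin.val_zero, pow_zero, one_smul]
  have swap : bilinPoly (M * (Gam (a 0) * (Gam x * gamProd (Fin.tail a)))) =
      -bilinPoly (M * (Gam x * (Gam (a 0) * gamProd (Fin.tail a)))) :=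
    bilinPoly_mul_Gam_mul_Gam_swap (h 0) _ _
  have inner : bilinPoly (M * Gam (a 0) * gamProd (i.insertNth x (Fin.tail a))) =
      (-1 : ℝ) ^ (i : ℕ) • bilinPoly (M * Gam (a 0) * (Gam x * gamProd (Fin.tail a))) := by
    cases n with
    | zero =>
      rw [Subsingleton.elim (α := Fin 1) i 0, Fin.insertNth_zero', gamProd_cons, Fin.val_zero,
        pow_zero, one_smul]
    | succ n =>
      refine bilinPoly_mul_gamProd_insertNth (fun j => ?_) i x
      have removeNth_succ : j.succ.removeNth a = Fin.cons (a 0) (j.removeNth (Fin.tail a)) := by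
        funext k
        refine Fin.cases ?_ (fun k => ?_) k <;> simp [Fin.removeNth, Fin.tail]
      rw [mul_assoc, ← gamProd_cons, ← removeNth_succ]
      exact h j.succ
  rw [mul_assoc, mul_assoc, swap] at inner
  rw [← Fin.cons_self_tail a, Fin.insertNth_succ_cons, gamProd_cons, gamProd_cons, inner,
    Fin.val_succ, pow_succ, mul_neg_one, neg_smul, smul_neg]

theorem d_bilinForm_of_bilinPoly_eq_zero
    (h : ∀ a : Fin n → Fin 11, Function.Injective a → bilinPoly (gamProd a) = 0) :
    superMink.d (bilinForm (n + 2)) = (n + 2 : ℝ) • ∑ a : Fin (n + 1) → Fin 11,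
      (∑ x, mink x • (bilin (Gam x) * bilin (Gam x * gamProd a))) * vielbProd a := by
  have move (i : Fin (n + 2)) (a : Fin (n + 1) → Fin 11) :
      (∑ x, mink x • (bilin (Gam x) * bilin (gamProd (i.insertNth x a)))) * vielbProd a =
        (-1 : ℝ) ^ (i : ℕ) •
          ((∑ x, mink x • (bilin (Gam x) * bilin (Gam x * gamProd a))) * vielbProd a) := by
    by_cases ha : Function.Injective a
    · have insert (x : Fin 11) : bilin (gamProd (i.insertNth x a)) =
          (-1 : ℝ) ^ (i : ℕ) • bilin (Gam x * gamProd a) := by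
        have h' := bilinPoly_mul_gamProd_insertNth (M := 1) (a := a)
          (fun j => by rw [one_mul]; exact h _ (ha.comp j.succAbove_right_injective)) i x
        rw [one_mul, one_mul] at h'
        rw [← psiPoly_bilinPoly, h', map_smul, psiPoly_bilinPoly]
      simp only [insert, mul_smul_comm, smul_comm _ ((-1 : ℝ) ^ (i : ℕ)), ← Finset.smul_sum,
        smul_mul_assoc]
    · rw [vielbProd_eq_zero ha, mul_zero, mul_zero, smul_zero]
  rw [d_bilinForm]
  simp only [move, ← Finset.smul_sum, smul_smul, ← mul_pow]
  simp only [mul_neg, mul_one, neg_neg, one_pow, one_smul, Finset.sum_const, Finset.card_univ,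
    Fintype.card_fin]
  rw [← Nat.cast_smul_eq_nsmul ℝ, Nat.cast_add n 2, Nat.cast_ofNat]

theorem G4_eq : G4 = (1 / 2 : ℝ) • bilinForm 2 := by
  rw [G4, sum_bilin_GamSkew]

theorem G7_eq : G7 = (1 / 120 : ℝ) • bilinForm 5 := by
  rw [G7, sum_bilin_GamSkew]
  norm_num [Nat.factorial]

theorem d_G4 : superMink.d G4 = 0 := by
  have fierz (a : Fin 1 → Fin 11) :
      ∑ x, mink x • (bilin (Gam x) * bilin (Gam x * gamProd a)) = 0 := by
    have h := congrArg psiPoly (sum_bilinPoly_Gam_mul_Gam (a 0))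
    simpa only [map_sum, map_smul, map_mul, psiPoly_bilinPoly, map_zero, gamProd, List.ofFn_succ,
      List.ofFn_zero, List.prod_singleton] using h
  rw [G4_eq, map_smul, d_bilinForm_of_bilinPoly_eq_zero fun a _ => by
    simpa [gamProd] using bilinPoly_one]
  simp only [fierz, zero_mul, Finset.sum_const_zero, smul_zero]

/-- The coefficient `(ψ̄ Γ_{a_0 a_1} ψ) (ψ̄ Γ_{a_2 a_3} ψ)` of `G₄ G₄`. -/
def bilinPair (a : Fin 4 → Fin 11) : GCA minkDeg :=
  bilin (Gam (a 0) * Gam (a 1)) * bilin (Gam (a 2) * Gam (a 3))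

theorem G4_mul_G4 : G4 * G4 = (1 / 4 : ℝ) • ∑ a, bilinPair a * vielbProd a := by
  have square : bilinForm 2 * bilinForm 2 = ∑ a, bilinPair a * vielbProd a := by
    rw [bilinForm, Finset.sum_mul_sum, ← (Fin.appendEquiv 2 2).sum_comp, Fintype.sum_prod_type]
    refine Finset.sum_congr rfl fun a _ => Finset.sum_congr rfl fun b _ => ?_
    change _ = bilinPair (Fin.append a b) * vielbProd (Fin.append a b)
    have entries : Fin.append a b = ![a 0, a 1, b 0, b 1] := by
      funext i
      fin_cases i <;> rfl
    rw [vielbProd_append, (commute_bilin (gamProd b) _).symm.mul_mul_mul_comm, bilinPair, entries]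
    simp [gamProd]
  rw [G4_eq, smul_mul_smul_comm, square]
  norm_num

theorem sum_bilin_Gam_mul_bilin_gamProd_four {a : Fin 4 → Fin 11} (ha : Function.Injective a) :
    ∑ x, mink x • (bilin (Gam x) * bilin (Gam x * gamProd a)) =
      bilinPair a - bilinPair (a ∘ Equiv.swap 1 2)
        + bilinPair (a ∘ (Equiv.swap 1 3 * Equiv.swap 2 3 : Equiv.Perm (Fin 4))) := by
  have h := congrArg psiPoly (sum_bilinPoly_Gam_mul_Gam_five (a 0) (c := a 1) (d := a 2) (e := a 3)
    (ha.ne (by decide)) (ha.ne (by decide)) (ha.ne (by decide)))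
  simp only [map_sum, map_smul, map_mul, map_add, map_sub, psiPoly_bilinPoly] at h
  have transposed : a ∘ Equiv.swap 1 2 = ![a 0, a 2, a 1, a 3] := by
    funext i
    fin_cases i <;> rfl
  have cycled : a ∘ (Equiv.swap 1 3 * Equiv.swap 2 3 : Equiv.Perm (Fin 4)) =
      ![a 0, a 3, a 1, a 2] := by
    funext i
    fin_cases i <;> rfl
  rw [transposed, cycled]
  simpa [gamProd, bilinPair] using h

theorem d_G7 : superMink.d G7 = (1 / 2 : ℝ) • (G4 * G4) := by
  have three_pairings : ∑ a : Fin 4 → Fin 11,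
      (∑ x, mink x • (bilin (Gam x) * bilin (Gam x * gamProd a))) * vielbProd a =
        (3 : ℝ) • ∑ a, bilinPair a * vielbProd a := by
    have expand (a : Fin 4 → Fin 11) :
        (∑ x, mink x • (bilin (Gam x) * bilin (Gam x * gamProd a))) * vielbProd a =
          bilinPair a * vielbProd a - bilinPair (a ∘ Equiv.swap 1 2) * vielbProd a
            + bilinPair (a ∘ (Equiv.swap 1 3 * Equiv.swap 2 3 : Equiv.Perm (Fin 4)))
              * vielbProd a := by
      by_cases ha : Function.Injective a
      · rw [sum_bilin_Gam_mul_bilin_gamProd_four ha, add_mul, sub_mul]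
      · simp only [vielbProd_eq_zero ha, mul_zero, sub_zero, add_zero]
    rw [Finset.sum_congr rfl fun a _ => expand a, Finset.sum_add_distrib, Finset.sum_sub_distrib,
      sum_mul_vielbProd_comp_perm bilinPair, sum_mul_vielbProd_comp_perm bilinPair, map_mul,
      Equiv.Perm.sign_swap (by decide), Equiv.Perm.sign_swap (by decide),
      Equiv.Perm.sign_swap (by decide), Units.neg_smul, neg_mul_neg]
    simp only [mul_one, one_smul]
    module
  rw [G7_eq, map_smul, d_bilinForm_of_bilinPoly_eq_zero fun a ha => by
    simpa [gamProd] using bilinPoly_Gam_three (ha.ne (by decide)) (ha.ne (by decide))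
      (ha.ne (by decide)), three_pairings, G4_mul_G4, smul_smul, smul_smul, smul_smul]
  norm_num

theorem G7_mem : G7 ∈ superMink.homog (2 * 3 + 1, 0) := by
  refine Submodule.smul_mem _ _ (Submodule.sum_mem _ fun a _ => ?_)
  have mem := mul_homog (bilin_mem (GamSkew a)) (prod_ofFn_mem fun i => vielb_mem (a i))
  have degree : ((2, 0) : BiDeg) + 5 • (1, 0) = (2 * 3 + 1, 0) := by decide
  rwa [degree] at mem

theorem isDualityDatum_G4 : IsDualityDatum superMink G4 (-G4) ((2 : ℝ) • G7) where
  isSuperLInfty := superMink_isSuperLInfty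
  mem_left := G4_mem
  mem_right := neg_G4_mem
  mem_K := Submodule.smul_mem _ _ G7_mem
  d_left := d_G4
  d_right := by rw [map_neg, d_G4, neg_zero]
  d_K := by
    rw [map_smul, d_G7, smul_smul, mul_neg, neg_neg]
    norm_num

theorem pageCharge_eq : pageCharge = extTwist superMink ((2 : ℝ) • G7) (-G4) := by
  rw [pageCharge, extTwist, map_neg, mul_neg, ← sub_eq_add_neg, map_smul, two_smul, two_mul]

theorem pageChargeMinus_eq : pageChargeMinus = extTwist superMink ((2 : ℝ) • G7) G4 := by
  rw [pageChargeMinus, extTwist, map_smul, two_smul, two_mul]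

end VielbeinForms

/-! ### Elements that are not closed -/

section NonClosed

open Presentation

theorem d_pow_eq_zero {g : Presentation} {x : g.CE} (hx : g.d x = 0) (n : ℕ) : g.d (x ^ n) = 0 := by
  induction n with
  | zero => rw [pow_zero, d_one]
  | succ n ih => rw [pow_succ, d_mul, ih, hx, zero_mul, mul_zero, add_zero]

/-- The evaluation `ψ^α ↦ 1`, `e^a ↦ 0`, an algebra map since the `ψ^α` commute; it detects
non-zero polynomials in the `ψ^α`. -/
def evalOne : GCA minkDeg →ₐ[ℝ] ℝ :=
  GCA.lift (fun | .psi _ => 1 | .e _ => 0) (by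
    rintro (α | a) (β | b) <;> simp [koszul, minkDeg, ZMod.val_one])

theorem evalOne_psi (α : SpinorIdx) : evalOne (psi α) = 1 := lift_gen _ _ _

theorem evalOne_bilin_Gam_zero : evalOne (bilin (Gam 0)) = -32 := by
  have h : spinorMetric * Gam 0 = -1 := spinorMetric_mul_self
  rw [bilin, h]
  simp only [map_sum, map_smul, map_mul, evalOne_psi, Matrix.neg_apply, Matrix.one_apply]
  simp

theorem psi_sq_mem : psi 0 ^ 2 ∈ superMink.homog (2, 0) := by
  have degree : minkDeg (.psi 0) + minkDeg (.psi 0) = (2, 0) := by simp only [minkDeg]; decide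
  have mul_mem := mul_homog (gen_mem (deg := minkDeg) (.psi 0)) (gen_mem (deg := minkDeg) (.psi 0))
  rw [degree, ← pow_two] at mul_mem
  exact mul_mem

theorem psi_sq_pow_mem (n : ℕ) : (psi 0 ^ 2) ^ n ∈ superMink.homog (2 * n, 0) := by
  have pow_mem := prod_ofFn_mem (n := n) fun _ => psi_sq_mem
  have degree : n • ((2, 0) : BiDeg) = ((2 * n, 0) : BiDeg) := by
    rw [Prod.smul_mk, smul_zero, nsmul_eq_mul, mul_comm]
  rw [List.ofFn_const, List.prod_replicate, degree] at pow_mem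
  exact pow_mem

theorem exists_d_ne_zero_superMink (n : ℕ) :
    ∃ z ∈ superMink.homog (2 * n + 1, 0), superMink.d z ≠ 0 := by
  have sq_closed : superMink.d (psi 0 ^ 2) = 0 := d_pow_eq_zero (d_psi 0) 2
  refine ⟨(psi 0 ^ 2) ^ n * vielb 0, by simpa using mul_homog (psi_sq_pow_mem n) (vielb_mem 0),
    fun h => ?_⟩
  rw [d_mul_of_closed (even_two_mul _) (psi_sq_pow_mem n) (d_pow_eq_zero sq_closed n),
    d_vielb] at h
  have evaluated := congrArg evalOne h
  rw [map_mul, map_smul, map_pow, map_pow, evalOne_psi, evalOne_bilin_Gam_zero, map_zero]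
    at evaluated
  norm_num [mink] at evaluated

end NonClosed

end SuperLInfty

end

theorem mainTheorem9 :
    -- `m2brane` and its reflected copy are super-`L_∞` algebras
    m2brane.IsSuperLInfty ∧ m2braneMinus.IsSuperLInfty ∧
    -- the Page charges are 7-cocycles, related by higher T-duality
    (∃ (H : Hom m2brane (lineAlg 6)) (H' : Hom m2braneMinus (lineAlg 6)),
      H.pull (lineGen 6) = pageCharge ∧ H'.pull (lineGen 6) = pageChargeMinus ∧
      TwistsTDual H H' ∧ TwistsTDual H' H) ∧
    -- the reflection isomorphism, which exchanges the Page charges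
    ∃ (ρ : Hom m2brane m2braneMinus) (ρ' : Hom m2braneMinus m2brane),
      ρ.pull.comp ρ'.pull = AlgHom.id ℝ m2brane.CE ∧
      ρ'.pull.comp ρ.pull = AlgHom.id ℝ m2braneMinus.CE ∧
      ρ.pull c3Minus = -c3 ∧ (∀ x, ρ.pull (pullPMinus x) = pullP x) ∧
      ρ.pull pageChargeMinus = pageCharge ∧
      ∀ m : ℤ,
        -- higher T-duality of twisted cocycles from `m2brane` to its reflected copy
        (∃ T : TwistedCocycle m2brane pageCharge m ≃
            TwistedCocycle m2braneMinus pageChargeMinus (m - 3),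
          (∀ F, CocyclesTDual F (T F)) ∧
          (∀ F k, (T F).comp k =
            - pullPMinus (fibP (F.comp k)) - c3Minus * pullPMinus (basP (F.comp (k - 1)))) ∧
          (∀ F' k, (T.symm F').comp k =
            - pullP (fibPMinus (F'.comp (k + 1))) - c3 * pullP (basPMinus (F'.comp k))) ∧
          -- the self-duality on `m2brane` obtained by pullback along the reflection
          ∃ S : TwistedCocycle m2brane pageCharge m ≃ TwistedCocycle m2brane pageCharge (m - 3),
            (∀ F, (S F).1.pull = ρ.pull.comp (T F).1.pull) ∧
            (∀ F k, (S F).comp k =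
              - pullP (fibP (F.comp k)) + c3 * pullP (basP (F.comp (k - 1)))) ∧
            ∃ F k, ∀ (j : ℤ) (c : ℝ), (S F).comp k ≠ c • F.comp j) ∧
        -- and vice versa
        (∃ T : TwistedCocycle m2braneMinus pageChargeMinus m ≃
            TwistedCocycle m2brane pageCharge (m - 3),
          (∀ F, CocyclesTDual F (T F)) ∧
          (∀ F k, (T F).comp k =
            - pullP (fibPMinus (F.comp k)) - c3 * pullP (basPMinus (F.comp (k - 1)))) ∧
          (∀ F' k, (T.symm F').comp k =
            - pullPMinus (fibP (F'.comp (k + 1))) - c3Minus * pullPMinus (basP (F'.comp k))) ∧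
          ∃ S : TwistedCocycle m2braneMinus pageChargeMinus m ≃
              TwistedCocycle m2braneMinus pageChargeMinus (m - 3),
            (∀ F, (S F).1.pull = ρ'.pull.comp (T F).1.pull) ∧
            (∀ F k, (S F).comp k =
              - pullPMinus (fibPMinus (F.comp k))
                + c3Minus * pullPMinus (basPMinus (F.comp (k - 1)))) ∧
            ∃ F k, ∀ (j : ℤ) (c : ℝ), (S F).comp k ≠ c • F.comp j) := by
  have D := isDualityDatum_G4
  have h' : G4 = -(-G4) := (neg_neg _).symm
  rw [pageCharge_eq, pageChargeMinus_eq]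
  refine ⟨D.ext_isSuperLInfty, D.symm.ext_isSuperLInfty, ?_, reflection D.mem_left D.mem_right rfl,
    reflection D.mem_right D.mem_left h', reflect_comp_self 2, reflect_comp_self 2,
    reflect_gen_none 2, reflect_basicIncl 2, D.reflection_extTwist rfl, fun m => ⟨?_, ?_⟩⟩
  · obtain ⟨H, hH⟩ := D.exists_hom_extTwist
    obtain ⟨H', hH'⟩ := D.symm.exists_hom_extTwist
    exact ⟨H, H', hH, hH', D.twistsTDual hH hH', D.symm.twistsTDual hH' hH⟩
  · exact ⟨D.dualEquiv m, D.cocyclesTDual, D.dualEquiv_comp, D.dualEquiv_symm_comp,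
      D.selfDualEquiv rfl m, fun _ => rfl, fun F => D.selfDualEquiv_comp F rfl,
      D.selfDualEquiv_nontrivial rfl exists_d_ne_zero_superMink m⟩
  · exact ⟨D.symm.dualEquiv m, D.symm.cocyclesTDual, D.symm.dualEquiv_comp,
      D.symm.dualEquiv_symm_comp, D.symm.selfDualEquiv h' m, fun _ => rfl,
      fun F => D.symm.selfDualEquiv_comp F h',
      D.symm.selfDualEquiv_nontrivial h' exists_d_ne_zero_superMink m⟩
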